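/- Let $\Bbbk$ be an algebraically closed field, $G$ an abelian group (written additively) and $\hat G=\mathrm{Hom}(G,\Bbbk^\times)$. Let $A=\bigoplus_{g\in G}A_g$ and $B=\bigoplus_{g\in G}B_g$ be finite dimensional unital associative $G$-graded $\Bbbk$-algebras. Let $A\text{-gmod}$ be the category of finite dimensional $G$-graded left $A$-modules with $A$-linear maps preserving degrees, and let $\Pi_g$ ($g\in G$) be the grading shift, $(\Pi_gM)_h=M_{h+g}$, regarded also as a functor on the bounded derived category $\mathcal D^b(A\text{-gmod})$; so $\Pi_0=\mathrm{Id}$ and $\Pi_{g+h}=\Pi_g\circ\Pi_h$. A $\Bbbk$-linear functor $F:\mathcal D^b(A\text{-gmod})\to\mathcal D^b(B\text{-gmod})$ is called graded if there are natural transformations $\xi^g:F\circ\Pi_g\Rightarrow\Pi_g\circ F$, $g\in G$, with $\xi^0=\mathrm{id}_F$ and $\Pi_g(\xi^h)\circ\xi^g_{\Pi_h}=\xi^{g+h}$ for all $g,h\in G$. The algebras $A$ and $B$ are called strongly gradable derived equivalent if there is a $\Bbbk$-linear, graded and triangulated functor $F:\mathcal D^b(A\text{-gmod})\to\mathcal D^b(B\text{-gmod})$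 with a (quasi-)inverse $F^{-1}$ which is also $\Bbbk$-linear, graded and triangulated, such that each of $F({}_AA)$ and $F^{-1}({}_BB)$ is isomorphic to a complex concentrated in a single degree. The $G$-centre of $A$ is the subalgebra $$\mathcal Z^G(A)=\{x:G\to A\;\mid\; x^{(g)}y=y\,x^{(g+h)}\text{ for all }g,h\in G,\ y\in A_h\}$$ of the algebra of all functions $G\to A$ with pointwise operations. It is $G$-graded by $\mathcal Z^G(A)_g=\{x\mid x^{(l)}\in A_g\text{ for all }l\in G\}$, the group $G$ acts on it by $(l\cdot x)^{(g)}=x^{(l+g)}$, and for $g\in G$, $\chi\in\hat G$ one puts $$\mathcal Z^G(A)_{g,\chi}=\{x\in\mathcal Z^G(A)_g\mid x^{(l)}=\chi(l)x^{(0)}\text{ for all }l\in G\}$$ (if $|G|$ is finite and not divisible by $\mathrm{char}(\Bbbk)$, these spaces form a $G\times\hat G$-grading of $\mathcal Z^G(A)$). Theorem. If $A$ and $B$ are strongly gradable derived equivalent, then there is an isomorphism of $\Bbbk$-algebras $\varphi:\mathcal Z^G(A)\to\mathcal Z^G(B)$ such that $\varphi(\mathcal Z^G(A)_g)=\mathcal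 Z^G(B)_g$ and $\varphi(\mathcal Z^G(A)_{g,\chi})=\mathcal Z^G(B)_{g,\chi}$ for all $g\in G$ and $\chi\in\hat G$, and $\varphi(l\cdot x)=l\cdot\varphi(x)$ for all $l\in G$ and $x\in\mathcal Z^G(A)$. -/

import Mathlib

noncomputable section

open CategoryTheory CategoryTheory.Limits

universe u v v' w

namespace GCentre

variable {k : Type u} [Field k] {G : Type w} [DecidableEq G]

lemma isInternal_of_proj {V : Type v} [AddCommGroup V] [Module k V] (d : G → Submodule k V)
    (p : G → V →ₗ[k] V) (h₁ : ∀ g v, v ∈ d g → p g v = v)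
    (h₂ : ∀ g h v, h ≠ g → v ∈ d h → p g v = 0) (h₃ : ⨆ g, d g = ⊤) :
    DirectSum.IsInternal d := by
  rw [DirectSum.isInternal_submodule_iff_iSupIndep_and_iSup_eq_top]
  refine ⟨fun g => ?_, h₃⟩
  rw [Submodule.disjoint_def]
  intro v hv hv'
  have : ⨆ (h : G) (_ : h ≠ g), d h ≤ LinearMap.ker (p g) :=
    iSup₂_le fun h hh w hw => h₂ g h w hh hw
  rw [← h₁ g v hv]
  exact this hv'

variable [AddCommGroup G]
  {A : Type v} [Ring A] [Algebra k A]

/-- A finite dimensional `G`-graded left module over the `G`-graded algebra `A = ⨁ g, 𝒜 g`. -/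
structure GMod (𝒜 : G → Submodule k A) where
  carrier : Type v
  [addCommGroup : AddCommGroup carrier]
  [moduleField : Module k carrier]
  [moduleAlg : Module A carrier]
  [isScalarTower : IsScalarTower k A carrier]
  [finite : Module.Finite k carrier]
  /-- the homogeneous components -/
  deg : G → Submodule k carrier
  isInternal : DirectSum.IsInternal deg
  smul_mem : ∀ {g h : G} {a : A} {v : carrier}, a ∈ 𝒜 g → v ∈ deg h → a • v ∈ deg (h + g)

namespace GMod

attribute [instance] addCommGroup moduleField moduleAlg isScalarTower finite

variable {𝒜 : G → Submodule k A}

instance : CoeSort (GMod 𝒜) (Type v) := ⟨GMod.carrier⟩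

/-- Morphisms of graded modules: `A`-linear maps which preserve degrees. -/
@[ext]
structure Hom (M N : GMod 𝒜) where
  lin : M →ₗ[A] N
  map_mem : ∀ (g : G) (v : M), v ∈ M.deg g → lin v ∈ N.deg g

instance : Category (GMod 𝒜) where
  Hom M N := Hom M N
  id M := ⟨LinearMap.id, fun _ _ h => h⟩
  comp f g := ⟨g.lin ∘ₗ f.lin, fun i v h => g.map_mem i _ (f.map_mem i v h)⟩

/-- The underlying linear map of a morphism. -/
def lin {M N : GMod 𝒜} (f : M ⟶ N) : M →ₗ[A] N := Hom.lin f

lemma lin_mem {M N : GMod 𝒜} (f : M ⟶ N) {g : G} {v : M} (h : v ∈ M.deg g) :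
    lin f v ∈ N.deg g := Hom.map_mem f g v h

/-- Constructor for morphisms. -/
def ofLin {M N : GMod 𝒜} (f : M →ₗ[A] N) (h : ∀ (g : G) (v : M), v ∈ M.deg g → f v ∈ N.deg g) :
    M ⟶ N := Hom.mk f h

@[simp] lemma lin_ofLin {M N : GMod 𝒜} (f : M →ₗ[A] N)
    (h : ∀ (g : G) (v : M), v ∈ M.deg g → f v ∈ N.deg g) : lin (ofLin f h) = f := rfl
@[simp] lemma lin_id (M : GMod 𝒜) : lin (𝟙 M) = LinearMap.id := rfl
@[simp] lemma lin_comp {M N P : GMod 𝒜} (f : M ⟶ N) (g : N ⟶ P) :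
    lin (f ≫ g) = lin g ∘ₗ lin f := rfl

lemma hom_ext {M N : GMod 𝒜} {f g : M ⟶ N} (h : ∀ v, lin f v = lin g v) : f = g :=
  Hom.ext (LinearMap.ext h)

/-! The preadditive and `k`-linear structures. -/

/-- Degree preserving linear maps, as a subspace of all linear maps. -/
def homSub (M N : GMod 𝒜) : AddSubgroup (M →ₗ[A] N) where
  carrier := {f | ∀ (g : G) (v : M), v ∈ M.deg g → f v ∈ N.deg g}
  zero_mem' := fun g _ _ => (N.deg g).zero_mem
  add_mem' := fun hf hf' g v h => (N.deg g).add_mem (hf g v h) (hf' g v h)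
  neg_mem' := fun hf g v h => (N.deg g).neg_mem (hf g v h)

/-- Morphisms are degree preserving linear maps. -/
def homEquiv (M N : GMod 𝒜) : (M ⟶ N) ≃ homSub M N where
  toFun f := ⟨lin f, fun _ _ h => lin_mem f h⟩
  invFun f := ofLin f.1 f.2
  left_inv _ := rfl
  right_inv _ := rfl

instance (M N : GMod 𝒜) : AddCommGroup (M ⟶ N) := (homEquiv M N).addCommGroup

@[simp] lemma lin_zero (M N : GMod 𝒜) : lin (0 : M ⟶ N) = 0 := rfl
@[simp] lemma lin_add {M N : GMod 𝒜} (f g : M ⟶ N) : lin (f + g) = lin f + lin g := rfl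

instance : Preadditive (GMod 𝒜) where
  add_comp _ _ _ f f' g := hom_ext fun v => by simp
  comp_add _ _ _ f g g' := hom_ext fun v => by simp

/-- `A`-linear maps are `k`-linear. -/
def klin {M N : GMod 𝒜} (f : M ⟶ N) : M →ₗ[k] N := (lin f).restrictScalars k

@[simp] lemma klin_apply {M N : GMod 𝒜} (f : M ⟶ N) (v : M) : klin f v = lin f v := rfl

lemma smul_comm_alg (M : GMod 𝒜) (c : k) (a : A) (v : M) : c • a • v = a • c • v := by
  rw [← algebraMap_smul A c (a • v), ← algebraMap_smul A c v, smul_smul, smul_smul,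
    Algebra.commutes]

instance (M N : GMod 𝒜) : SMul k (M ⟶ N) where
  smul c f := ofLin
    { toFun := fun v => c • lin f v
      map_add' := fun v v' => by simp
      map_smul' := fun a v => by simp [smul_comm_alg] }
    (fun g v h => (N.deg g).smul_mem c (lin_mem f h))

@[simp] lemma lin_smul_apply {M N : GMod 𝒜} (c : k) (f : M ⟶ N) (v : M) :
    lin (c • f) v = c • lin f v := rfl

instance (M N : GMod 𝒜) : Module k (M ⟶ N) where
  one_smul f := hom_ext fun v => by simp
  mul_smul c d f := hom_ext fun v => by simp [mul_smul]
  smul_zero c := hom_ext fun v => by simp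
  smul_add c f g := hom_ext fun v => by simp
  add_smul c d f := hom_ext fun v => by simp [add_smul]
  zero_smul f := hom_ext fun v => by simp

instance : Linear k (GMod 𝒜) where
  smul_comp _ _ _ c f g := hom_ext fun v => by
    exact (klin g).map_smul c (lin f v)
  comp_smul _ _ _ f c g := hom_ext fun v => by simp

/-! Homogeneous projections. -/

lemma iSup_deg (M : GMod 𝒜) : ⨆ g, M.deg g = ⊤ := M.isInternal.submodule_iSup_eq_top

/-- A graded module is the direct sum of its homogeneous components. -/
def decomp (M : GMod 𝒜) : (DirectSum G fun g => M.deg g) ≃ₗ[k] M :=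
  LinearEquiv.ofBijective (DirectSum.coeLinearMap M.deg) (show Function.Bijective _ from
    M.isInternal)

/-- The projection on the component of degree `g`. -/
def proj (M : GMod 𝒜) (g : G) : M →ₗ[k] M :=
  (M.deg g).subtype ∘ₗ DirectSum.component k G _ g ∘ₗ M.decomp.symm.toLinearMap

lemma proj_mem (M : GMod 𝒜) (g : G) (v : M) : M.proj g v ∈ M.deg g := by
  simp [proj]

lemma decomp_symm (M : GMod 𝒜) {g : G} {v : M} (h : v ∈ M.deg g) :
    M.decomp.symm v = DirectSum.lof k G (fun g => M.deg g) g ⟨v, h⟩ := by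
  rw [LinearEquiv.symm_apply_eq]
  exact (DirectSum.coeLinearMap_lof M.deg g ⟨v, h⟩).symm

lemma proj_of_mem (M : GMod 𝒜) {g : G} {v : M} (h : v ∈ M.deg g) : M.proj g v = v := by
  simp [proj, decomp_symm M h, DirectSum.component.lof_self]

lemma proj_of_mem_ne (M : GMod 𝒜) {g h : G} (hh : h ≠ g) {v : M} (hv : v ∈ M.deg h) :
    M.proj g v = 0 := by
  simp [proj, decomp_symm M hv, DirectSum.component.of, hh]

lemma lin_proj {M N : GMod 𝒜} (f : M ⟶ N) (g : G) (v : M) :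
    lin f (M.proj g v) = N.proj g (lin f v) := by
  have : ⊤ ≤ LinearMap.eqLocus (klin f ∘ₗ M.proj g) (N.proj g ∘ₗ klin f) := by
    rw [← M.iSup_deg]
    refine iSup_le fun h w hw => ?_
    by_cases hh : h = g
    · subst hh
      simp [LinearMap.mem_eqLocus, proj_of_mem M hw, proj_of_mem N (lin_mem f hw)]
    · simp [LinearMap.mem_eqLocus, proj_of_mem_ne M hh hw, proj_of_mem_ne N hh (lin_mem f hw)]
  exact this (Submodule.mem_top (x := v))

lemma mem_of_forall_proj (M : GMod 𝒜) (S : Submodule k M) {v : M} (h : ∀ g, M.proj g v ∈ S) :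
    v ∈ S := by
  classical
  have : v = ∑ g ∈ (M.decomp.symm v).support, M.proj g v := by
    conv_lhs => rw [← M.decomp.apply_symm_apply v]
    change DirectSum.coeAddMonoidHom M.deg (M.decomp.symm v) = _
    rw [DirectSum.coeAddMonoidHom_eq_dfinsuppSum]
    rfl
  rw [this]
  exact Submodule.sum_mem _ fun g _ => h g

/-! Zero object and binary biproducts. -/

/-- The zero module. -/
def zeroObj (𝒜 : G → Submodule k A) : GMod 𝒜 where
  carrier := PUnit
  deg _ := ⊤
  isInternal := isInternal_of_proj _ (fun _ => 0) (fun _ _ _ => rfl) (fun _ _ _ _ _ => rfl)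
    (by simp)
  smul_mem _ _ := Submodule.mem_top

instance : HasZeroObject (GMod 𝒜) where
  zero := ⟨zeroObj 𝒜, by
    rw [IsZero.iff_id_eq_zero]
    exact hom_ext fun _ => rfl⟩

/-- The direct sum of two graded modules. -/
def prod (M N : GMod 𝒜) : GMod 𝒜 where
  carrier := M × N
  deg g := (M.deg g).prod (N.deg g)
  isInternal := isInternal_of_proj _ (fun g => (M.proj g).prodMap (N.proj g))
    (fun g v h => Prod.ext (M.proj_of_mem h.1) (N.proj_of_mem h.2))
    (fun g h v hh hv => Prod.ext (M.proj_of_mem_ne hh hv.1) (N.proj_of_mem_ne hh hv.2))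
    (by
      rw [eq_top_iff]
      rintro ⟨x, y⟩ -
      have hx : x ∈ (⨆ g, (M.deg g).prod (N.deg g)).comap (LinearMap.inl k M N) :=
        M.mem_of_forall_proj _ fun g =>
          Submodule.mem_iSup_of_mem g ⟨M.proj_mem g x, (N.deg g).zero_mem⟩
      have hy : y ∈ (⨆ g, (M.deg g).prod (N.deg g)).comap (LinearMap.inr k M N) :=
        N.mem_of_forall_proj _ fun g =>
          Submodule.mem_iSup_of_mem g ⟨(M.deg g).zero_mem, N.proj_mem g y⟩
      simpa using Submodule.add_mem (⨆ g, (M.deg g).prod (N.deg g)) hx hy)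
  smul_mem ha hv := ⟨M.smul_mem ha hv.1, N.smul_mem ha hv.2⟩


instance : HasBinaryBiproducts (GMod 𝒜) where
  has_binary_biproduct M N := hasBinaryBiproduct_of_total
    { pt := prod M N
      fst := ofLin (LinearMap.fst A M N) fun _ _ h => h.1
      snd := ofLin (LinearMap.snd A M N) fun _ _ h => h.2
      inl := ofLin (LinearMap.inl A M N) fun g _ h => ⟨h, (N.deg g).zero_mem⟩
      inr := ofLin (LinearMap.inr A M N) fun g _ h => ⟨(M.deg g).zero_mem, h⟩
      inl_fst := rfl
      inl_snd := rfl
      inr_fst := rfl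
      inr_snd := rfl }
    (hom_ext fun v => Prod.ext (add_zero v.1) (zero_add v.2))

instance : HasFiniteProducts (GMod 𝒜) := hasFiniteProducts_of_has_binary_and_terminal

/-! Kernels and cokernels. -/

section

variable {M N : GMod 𝒜} (f : M ⟶ N)

/-- The kernel of a morphism, with the induced grading. -/
def ker : GMod 𝒜 where
  carrier := LinearMap.ker (lin f)
  finite := Module.Finite.of_injective ((LinearMap.ker (lin f)).subtype.restrictScalars k)
    Subtype.val_injective
  deg g := (M.deg g).comap ((LinearMap.ker (lin f)).subtype.restrictScalars k)
  isInternal := isInternal_of_proj _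
    (fun g => (M.proj g).restrict (p := LinearMap.ker (klin f)) (q := LinearMap.ker (klin f))
      (fun v hv => by
        have hv' : lin f v = 0 := hv
        simp [lin_proj, hv']))
    (fun g v h => Subtype.ext (M.proj_of_mem h))
    (fun g h v hh hv => Subtype.ext (M.proj_of_mem_ne hh hv))
    (by
      rw [eq_top_iff]
      rintro ⟨v, hv⟩ -
      have : v ∈ (⨆ g, (M.deg g).comap
          ((LinearMap.ker (lin f)).subtype.restrictScalars k)).map
            ((LinearMap.ker (lin f)).subtype.restrictScalars k) := by
        refine M.mem_of_forall_proj _ fun g => ?_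
        refine ⟨⟨M.proj g v, ?_⟩, Submodule.mem_iSup_of_mem g (M.proj_mem g v), rfl⟩
        have hv' : lin f v = 0 := hv
        simp [lin_proj, hv']
      obtain ⟨w, hw, rfl⟩ := this
      exact hw)
  smul_mem ha hv := M.smul_mem ha hv

/-- The inclusion of the kernel. -/
def kerι : ker f ⟶ M := ofLin (LinearMap.ker (lin f)).subtype fun _ _ h => h

lemma kerι_comp : kerι f ≫ f = 0 := hom_ext fun v => v.2

/-- The kernel has the universal property. -/
def kerIsLimit : IsLimit (KernelFork.ofι (kerι f) (kerι_comp f)) :=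
  KernelFork.IsLimit.ofι _ _
    (fun g hg => ofLin ((lin g).codRestrict _ fun w =>
        LinearMap.mem_ker.2 (LinearMap.congr_fun (congrArg lin hg) w))
      (fun _ _ h => lin_mem g h))
    (fun _ _ => rfl)
    (fun _ _ _ hm => hom_ext fun w => Subtype.ext (LinearMap.congr_fun (congrArg lin hm) w))

instance : HasKernels (GMod 𝒜) := ⟨fun f => ⟨⟨_, kerIsLimit f⟩⟩⟩

/-- The projections on the homogeneous components of the cokernel. -/
def cokerProj (g : G) : (N ⧸ LinearMap.range (lin f)) →ₗ[k] (N ⧸ LinearMap.range (lin f)) :=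
  (((LinearMap.range (lin f)).restrictScalars k).liftQ
    ((LinearMap.range (lin f)).mkQ.restrictScalars k ∘ₗ N.proj g) (by
      rintro _ ⟨v, rfl⟩
      exact (Submodule.Quotient.mk_eq_zero _).2 ⟨M.proj g v, lin_proj f g v⟩)) ∘ₗ
    (Submodule.Quotient.restrictScalarsEquiv k (LinearMap.range (lin f))).symm.toLinearMap

lemma cokerProj_mkQ (g : G) (v : N) :
    cokerProj f g ((LinearMap.range (lin f)).mkQ v) =
      (LinearMap.range (lin f)).mkQ (N.proj g v) := rfl

/-- The homogeneous components of the cokernel. -/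
def cokerDeg (g : G) : Submodule k (N ⧸ LinearMap.range (lin f)) :=
  (N.deg g).map ((LinearMap.range (lin f)).mkQ.restrictScalars k)

lemma mem_cokerDeg {g : G} {q : N ⧸ LinearMap.range (lin f)} :
    q ∈ cokerDeg f g ↔ ∃ v ∈ N.deg g, (LinearMap.range (lin f)).mkQ v = q := Iff.rfl

lemma coker_isInternal : DirectSum.IsInternal (cokerDeg f) := by
  refine isInternal_of_proj _ (cokerProj f) (fun g q hq => ?_) (fun g h q hh hq => ?_) ?_
  · obtain ⟨v, hv, rfl⟩ := (mem_cokerDeg f).1 hq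
    rw [cokerProj_mkQ, N.proj_of_mem hv]
  · obtain ⟨v, hv, rfl⟩ := (mem_cokerDeg f).1 hq
    rw [cokerProj_mkQ, N.proj_of_mem_ne hh hv, map_zero]
  · unfold cokerDeg
    rw [← Submodule.map_iSup, N.iSup_deg, Submodule.map_top, LinearMap.range_eq_top]
    exact (LinearMap.range (lin f)).mkQ_surjective

/-- The cokernel of a morphism, with the induced grading. -/
def coker : GMod 𝒜 where
  carrier := N ⧸ LinearMap.range (lin f)
  finite := Module.Finite.of_surjective ((LinearMap.range (lin f)).mkQ.restrictScalars k)
    (LinearMap.range (lin f)).mkQ_surjective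
  deg := cokerDeg f
  isInternal := coker_isInternal f
  smul_mem := by
    intro g h a q ha hq
    obtain ⟨v, hv, rfl⟩ := (mem_cokerDeg f).1 hq
    exact ⟨a • v, N.smul_mem ha hv, rfl⟩

/-- The projection on the cokernel. -/
def cokerπ : N ⟶ coker f := ofLin (LinearMap.range (lin f)).mkQ fun _ v h => ⟨v, h, rfl⟩

lemma comp_cokerπ : f ≫ cokerπ f = 0 :=
  hom_ext fun v => (Submodule.Quotient.mk_eq_zero _).2 ⟨v, rfl⟩

/-- The cokernel has the universal property. -/
def cokerIsColimit : IsColimit (CokernelCofork.ofπ (cokerπ f) (comp_cokerπ f)) :=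
  CokernelCofork.IsColimit.ofπ _ _
    (fun g hg => ofLin ((LinearMap.range (lin f)).liftQ (lin g) (by
        rintro _ ⟨v, rfl⟩
        exact LinearMap.congr_fun (congrArg lin hg) v))
      (by
        rintro i _ ⟨v, hv, rfl⟩
        exact lin_mem g hv))
    (fun _ _ => rfl)
    (fun _ _ _ hm => hom_ext fun w => by
      obtain ⟨v, rfl⟩ := Submodule.mkQ_surjective _ w
      exact LinearMap.congr_fun (congrArg lin hm) v)

instance : HasCokernels (GMod 𝒜) := ⟨fun f => ⟨⟨_, cokerIsColimit f⟩⟩⟩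

lemma injective_of_mono [Mono f] : Function.Injective (lin f) := by
  rw [← LinearMap.ker_eq_bot, eq_bot_iff]
  intro v hv
  have : kerι f = 0 := by
    rw [← cancel_mono f, kerι_comp, zero_comp]
  exact LinearMap.congr_fun (congrArg lin this) ⟨v, hv⟩

lemma surjective_of_epi [Epi f] : Function.Surjective (lin f) := by
  intro v
  have : cokerπ f = 0 := by
    rw [← cancel_epi f, comp_cokerπ, comp_zero]
  exact (Submodule.Quotient.mk_eq_zero _).1 (LinearMap.congr_fun (congrArg lin this) v)

/-- A monomorphism is the kernel of its cokernel. -/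
@[reducible]
def normalMono [Mono f] : NormalMono f where
  Z := coker f
  g := cokerπ f
  w := comp_cokerπ f
  isLimit := KernelFork.IsLimit.ofι' _ _ fun {W} g hg => by
    have hr : ∀ w, lin g w ∈ LinearMap.range (lin f) := fun w =>
      (Submodule.Quotient.mk_eq_zero _).1 (LinearMap.congr_fun (congrArg lin hg) w)
    let e := LinearEquiv.ofInjective (lin f) (injective_of_mono f)
    have he : ∀ w, lin f (e.symm ((lin g).codRestrict _ hr w)) = lin g w := fun w =>
      congrArg Subtype.val (e.apply_symm_apply ((lin g).codRestrict _ hr w))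
    refine ⟨ofLin (e.symm.toLinearMap ∘ₗ (lin g).codRestrict _ hr) fun i w hw => ?_,
      hom_ext he⟩
    have : M.proj i (e.symm ((lin g).codRestrict _ hr w)) =
        e.symm ((lin g).codRestrict _ hr w) := by
      apply injective_of_mono f
      rw [lin_proj, he, N.proj_of_mem (lin_mem g hw)]
    change e.symm ((lin g).codRestrict _ hr w) ∈ M.deg i
    rw [← this]
    exact M.proj_mem _ _

/-- An epimorphism is the cokernel of its kernel. -/
@[reducible]
def normalEpi [Epi f] : NormalEpi f where
  W := ker f
  g := kerι f
  w := kerι_comp f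
  isColimit := CokernelCofork.IsColimit.ofπ' _ _ fun {W} g hg => by
    let e := (lin f).quotKerEquivOfSurjective (surjective_of_epi f)
    have hk : LinearMap.ker (lin f) ≤ LinearMap.ker (lin g) := fun v hv =>
      LinearMap.congr_fun (congrArg lin hg) (⟨v, hv⟩ : LinearMap.ker (lin f))
    have he : ∀ v, (LinearMap.ker (lin f)).liftQ (lin g) hk (e.symm (lin f v)) = lin g v := by
      intro v
      have : e.symm (lin f v) = (LinearMap.ker (lin f)).mkQ v := by
        rw [LinearEquiv.symm_apply_eq]; rfl
      rw [this]; rfl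
    refine ⟨ofLin ((LinearMap.ker (lin f)).liftQ (lin g) hk ∘ₗ e.symm.toLinearMap)
      fun i w hw => ?_, hom_ext he⟩
    obtain ⟨v, rfl⟩ := surjective_of_epi f w
    have : lin f v = lin f (M.proj i v) := by rw [lin_proj, N.proj_of_mem hw]
    change (LinearMap.ker (lin f)).liftQ (lin g) hk (e.symm (lin f v)) ∈ W.deg i
    rw [this, he]
    exact lin_mem g (M.proj_mem i v)

end

instance : Abelian (GMod 𝒜) where
  normalMonoOfMono f _ := ⟨normalMono f⟩
  normalEpiOfEpi f _ := ⟨normalEpi f⟩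

end GMod

/-! The grading shift functors. -/

namespace GMod

/-- The shifted module: the same module, with `(Π_g M)_h = M_{h + g}`. -/
def shiftObj (g : G) {𝒜 : G → Submodule k A} (M : GMod 𝒜) : GMod 𝒜 where
  carrier := M.carrier
  deg h := M.deg (h + g)
  isInternal := isInternal_of_proj _ (fun h => M.proj (h + g))
    (fun _ _ hv => M.proj_of_mem hv)
    (fun _ _ _ hh hv => M.proj_of_mem_ne (fun e => hh (add_right_cancel e)) hv)
    (by rw [← M.iSup_deg]; exact (Equiv.addRight g).iSup_comp (g := M.deg))
  smul_mem {i h a v} ha hv := by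
    have := M.smul_mem ha hv
    rwa [add_right_comm] at this

/-- The grading shift functor `Π_g`, which does not change the underlying linear maps. -/
def shift (𝒜 : G → Submodule k A) (g : G) : GMod 𝒜 ⥤ GMod 𝒜 where
  obj M := shiftObj g M
  map {M N} f := Hom.mk (M := shiftObj g M) (N := shiftObj g N) (lin (M := M) (N := N) f)
    fun h _ hv => lin_mem (M := M) (N := N) (g := h + g) f hv

variable (𝒜 : G → Submodule k A)

/-- `Π_0` is the identity functor; the isomorphism is the identity on underlying modules. -/
def shiftZero : shift 𝒜 0 ≅ 𝟭 (GMod 𝒜) :=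
  NatIso.ofComponents (fun M =>
    { hom := Hom.mk (LinearMap.id : M →ₗ[A] M) fun g v (h : v ∈ M.deg (g + 0)) => by
        rwa [add_zero] at h
      inv := Hom.mk (LinearMap.id : M →ₗ[A] M) fun g v (h : v ∈ M.deg g) => by
        change v ∈ M.deg (g + 0)
        rwa [add_zero]
      hom_inv_id := rfl
      inv_hom_id := rfl }) (fun _ => rfl)

/-- `Π_{g + h}` is the composition `Π_g ∘ Π_h`; the isomorphism is the identity on underlying
modules. -/
def shiftAdd (g h : G) : shift 𝒜 (g + h) ≅ shift 𝒜 h ⋙ shift 𝒜 g :=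
  NatIso.ofComponents (fun M =>
    { hom := Hom.mk (LinearMap.id : M →ₗ[A] M) fun i v (hv : v ∈ M.deg (i + (g + h))) => by
        change v ∈ M.deg (i + g + h)
        rwa [add_assoc]
      inv := Hom.mk (LinearMap.id : M →ₗ[A] M) fun i v (hv : v ∈ M.deg (i + g + h)) => by
        change v ∈ M.deg (i + (g + h))
        rwa [← add_assoc]
      hom_inv_id := rfl
      inv_hom_id := rfl }) (fun _ => rfl)

instance (g : G) : (shift 𝒜 g).Additive where
  map_add := rfl

instance (g : G) : (shift 𝒜 g).Linear k where
  map_smul _ _ := rfl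

/-- The inverse of `Π_g` is `Π_{-g}`. -/
def shiftEquivalence (g : G) : GMod 𝒜 ≌ GMod 𝒜 :=
  CategoryTheory.Equivalence.mk (shift 𝒜 g) (shift 𝒜 (-g))
    ((shiftZero 𝒜).symm ≪≫ eqToIso (by rw [neg_add_cancel]) ≪≫ shiftAdd 𝒜 (-g) g)
    ((shiftAdd 𝒜 g (-g)).symm ≪≫ eqToIso (by rw [add_neg_cancel]) ≪≫ shiftZero 𝒜)

instance (g : G) : (shift 𝒜 g).IsEquivalence := (shiftEquivalence 𝒜 g).isEquivalence_functor

instance : HasDerivedCategory (GMod 𝒜) := HasDerivedCategory.standard _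

end GMod

/-! The bounded derived category and the shift functors on it. -/

section

variable (𝒜 : G → Submodule k A)

/-- The bounded derived category of finite dimensional graded modules. -/
abbrev Db := DerivedCategory.Bounded (GMod 𝒜)

/-- A graded module `M`, regarded as a complex concentrated in cohomological degree `n`. -/
def single (n : ℤ) (M : GMod 𝒜) : Db 𝒜 where
  obj := (DerivedCategory.singleFunctor (GMod 𝒜) n).obj M
  property := ⟨⟨n, inferInstance⟩, ⟨n, inferInstance⟩⟩

lemma bounded_map (g : G) (X : DerivedCategory (GMod 𝒜))
    (hX : DerivedCategory.TStructure.t.bounded X) :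
    DerivedCategory.TStructure.t.bounded ((GMod.shift 𝒜 g).mapDerivedCategory.obj X) := by
  obtain ⟨⟨a, K, eK, hK⟩, ⟨b, L, eL, hL⟩⟩ := hX
  refine ⟨⟨a, ((GMod.shift 𝒜 g).mapHomologicalComplex _).obj K,
    (GMod.shift 𝒜 g).mapDerivedCategory.mapIso eK ≪≫
      (GMod.shift 𝒜 g).mapDerivedCategoryFactors.app K, inferInstance⟩,
    ⟨b, ((GMod.shift 𝒜 g).mapHomologicalComplex _).obj L,
    (GMod.shift 𝒜 g).mapDerivedCategory.mapIso eL ≪≫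
      (GMod.shift 𝒜 g).mapDerivedCategoryFactors.app L, inferInstance⟩⟩

/-- The functor on the bounded derived category induced by the exact functor `Π_g`. -/
def dShift (g : G) : Db 𝒜 ⥤ Db 𝒜 :=
  DerivedCategory.TStructure.t.bounded.lift
    (DerivedCategory.Bounded.ι ⋙ (GMod.shift 𝒜 g).mapDerivedCategory)
    (fun X => bounded_map 𝒜 g X.obj X.property)

/-- The canonical isomorphism `Π_0 ≅ Id` on complexes, degreewise the one on modules. -/
def cShiftZero : (GMod.shift 𝒜 0).mapHomologicalComplex (ComplexShape.up ℤ) ≅ 𝟭 _ :=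
  NatIso.ofComponents (fun K => HomologicalComplex.Hom.isoOfComponents
    (fun i => (GMod.shiftZero 𝒜).app (K.X i)) (fun i j _ => ((GMod.shiftZero 𝒜).hom.naturality (K.d i j)).symm))
    (fun f => by ext i; exact (GMod.shiftZero 𝒜).hom.naturality (f.f i))

/-- The canonical isomorphism `Π_{g + h} ≅ Π_g ∘ Π_h` on complexes, degreewise the one on
modules. -/
def cShiftAdd (g h : G) :
    (GMod.shift 𝒜 (g + h)).mapHomologicalComplex (ComplexShape.up ℤ) ≅
      (GMod.shift 𝒜 h).mapHomologicalComplex (ComplexShape.up ℤ) ⋙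
        (GMod.shift 𝒜 g).mapHomologicalComplex (ComplexShape.up ℤ) :=
  NatIso.ofComponents (fun K => HomologicalComplex.Hom.isoOfComponents
    (fun i => (GMod.shiftAdd 𝒜 g h).app (K.X i))
    (fun i j _ => ((GMod.shiftAdd 𝒜 g h).hom.naturality (K.d i j)).symm))
    (fun f => by ext i; exact (GMod.shiftAdd 𝒜 g h).hom.naturality (f.f i))

/-- `Π_g ∘ Π_h` on the derived category is induced by `Π_g ∘ Π_h` on complexes. -/
@[reducible]
def compLifting (g h : G) :
    Localization.Lifting DerivedCategory.Q
      (HomologicalComplex.quasiIso (GMod 𝒜) (ComplexShape.up ℤ))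
      (((GMod.shift 𝒜 h).mapHomologicalComplex (ComplexShape.up ℤ) ⋙
        (GMod.shift 𝒜 g).mapHomologicalComplex (ComplexShape.up ℤ)) ⋙ DerivedCategory.Q)
      ((GMod.shift 𝒜 h).mapDerivedCategory ⋙ (GMod.shift 𝒜 g).mapDerivedCategory) where
  iso := (Functor.associator _ _ _).symm ≪≫
    Functor.isoWhiskerRight (GMod.shift 𝒜 h).mapDerivedCategoryFactors _ ≪≫
    Functor.associator _ _ _ ≪≫
    Functor.isoWhiskerLeft _ (GMod.shift 𝒜 g).mapDerivedCategoryFactors ≪≫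
    (Functor.associator _ _ _).symm

/-- The isomorphism `Π_0 ≅ Id` on the derived category induced by the one on complexes. -/
def derShiftZero : (GMod.shift 𝒜 0).mapDerivedCategory ≅ 𝟭 (DerivedCategory (GMod 𝒜)) :=
  Localization.liftNatIso DerivedCategory.Q
    (HomologicalComplex.quasiIso (GMod 𝒜) (ComplexShape.up ℤ))
    ((GMod.shift 𝒜 0).mapHomologicalComplex (ComplexShape.up ℤ) ⋙ DerivedCategory.Q)
    DerivedCategory.Q _ _
    (Functor.isoWhiskerRight (cShiftZero 𝒜) DerivedCategory.Q ≪≫ Functor.leftUnitor _)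

/-- The isomorphism `Π_{g + h} ≅ Π_g ∘ Π_h` on the derived category induced by the one on
complexes. -/
def derShiftAdd (g h : G) : (GMod.shift 𝒜 (g + h)).mapDerivedCategory ≅
    (GMod.shift 𝒜 h).mapDerivedCategory ⋙ (GMod.shift 𝒜 g).mapDerivedCategory :=
  letI := compLifting 𝒜 g h
  Localization.liftNatIso DerivedCategory.Q
    (HomologicalComplex.quasiIso (GMod 𝒜) (ComplexShape.up ℤ))
    ((GMod.shift 𝒜 (g + h)).mapHomologicalComplex (ComplexShape.up ℤ) ⋙ DerivedCategory.Q)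
    (((GMod.shift 𝒜 h).mapHomologicalComplex (ComplexShape.up ℤ) ⋙
        (GMod.shift 𝒜 g).mapHomologicalComplex (ComplexShape.up ℤ)) ⋙ DerivedCategory.Q) _ _
    (Functor.isoWhiskerRight (cShiftAdd 𝒜 g h) DerivedCategory.Q)

/-- The canonical isomorphism `Π_0 ≅ Id` on the bounded derived category. -/
def dShiftZero : dShift 𝒜 0 ≅ 𝟭 (Db 𝒜) :=
  NatIso.ofComponents
    (fun X => ObjectProperty.isoMk _ ((derShiftZero 𝒜).app X.obj))
    (fun f => ObjectProperty.hom_ext _ ((derShiftZero 𝒜).hom.naturality f.hom))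

/-- The canonical isomorphism `Π_{g + h} ≅ Π_g ∘ Π_h` on the bounded derived category. -/
def dShiftAdd (g h : G) : dShift 𝒜 (g + h) ≅ dShift 𝒜 h ⋙ dShift 𝒜 g :=
  NatIso.ofComponents
    (fun X => ObjectProperty.isoMk _ ((derShiftAdd 𝒜 g h).app X.obj))
    (fun f => ObjectProperty.hom_ext _ ((derShiftAdd 𝒜 g h).hom.naturality f.hom))

/-- The left regular graded module. -/
def regular [GradedAlgebra 𝒜] [Module.Finite k A] : GMod 𝒜 where
  carrier := A
  deg := 𝒜
  isInternal := DirectSum.Decomposition.isInternal 𝒜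
  smul_mem {g h a v} ha hv := by
    rw [add_comm h g]
    exact SetLike.mul_mem_graded ha hv

/-- The object is isomorphic in the derived category to a complex concentrated in one degree. -/
def IsInOneDegree (X : Db 𝒜) : Prop :=
  ∃ (n : ℤ) (M : GMod 𝒜), Nonempty (X ≅ single 𝒜 n M)

end

/-! Gradable derived equivalences. -/

section

variable {B : Type v'} [Ring B] [Algebra k B]

/-- A structure of graded functor: natural transformations `ξ^g : F ∘ Π_g ⟶ Π_g ∘ F` which
intertwine the actions of `G`, that is, `ξ^0 = id` and `Π_g(ξ^h) ∘ ξ^g_{Π_h} = ξ^{g + h}`, up to the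
canonical identifications `Π_0 = Id` and `Π_{g + h} = Π_g ∘ Π_h`. -/
structure Intertwining {𝒜 : G → Submodule k A} {ℬ : G → Submodule k B} (F : Db 𝒜 ⥤ Db ℬ) where
  ξ : ∀ g : G, dShift 𝒜 g ⋙ F ⟶ F ⋙ dShift ℬ g
  ξ_zero : ∀ X : Db 𝒜,
    (ξ 0).app X ≫ (dShiftZero ℬ).hom.app (F.obj X) = F.map ((dShiftZero 𝒜).hom.app X)
  ξ_add : ∀ (g h : G) (X : Db 𝒜),
    F.map ((dShiftAdd 𝒜 g h).hom.app X) ≫ (ξ g).app ((dShift 𝒜 h).obj X) ≫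
        (dShift ℬ g).map ((ξ h).app X) =
      (ξ (g + h)).app X ≫ (dShiftAdd ℬ g h).hom.app (F.obj X)

/-- The functor is `k`-linear, triangulated and graded. -/
structure IsGradedTriangulated {𝒜 : G → Submodule k A} {ℬ : G → Submodule k B}
    (F : Db 𝒜 ⥤ Db ℬ) : Prop where
  linear : F.Linear k
  triangulated : ∃ _ : F.CommShift ℤ, F.IsTriangulated
  graded : Nonempty (Intertwining F)

/-- Two finite dimensional graded algebras are strongly gradable derived equivalent if there is a
graded triangulated functor between the bounded derived categories of graded modules which has an
inverse of the same kind, such that these two functors send the regular modules to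
complexes concentrated in one degree. -/
def StronglyGradableDerivedEquivalent (𝒜 : G → Submodule k A) (ℬ : G → Submodule k B)
    [GradedAlgebra 𝒜] [GradedAlgebra ℬ] [Module.Finite k A] [Module.Finite k B] : Prop :=
  ∃ e : Db 𝒜 ≌ Db ℬ, IsGradedTriangulated e.functor ∧ IsGradedTriangulated e.inverse ∧
    IsInOneDegree ℬ (e.functor.obj (single 𝒜 0 (regular 𝒜))) ∧
    IsInOneDegree 𝒜 (e.inverse.obj (single ℬ 0 (regular ℬ)))

end

/-! The `G`-centre. -/

section

variable (𝒜 : G → Submodule k A)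

/-- The `G`-centre, a subalgebra of the algebra of all functions from `G` to `A`. -/
def gCentre : Subalgebra k (G → A) where
  carrier := {x | ∀ (g h : G) (y : A), y ∈ 𝒜 h → x g * y = y * x (g + h)}
  mul_mem' {x x'} hx hx' g h y hy := by
    simp only [Pi.mul_apply]
    rw [mul_assoc, hx' g h y hy, ← mul_assoc, hx g h y hy, mul_assoc]
  add_mem' {x x'} hx hx' g h y hy := by
    simp only [Pi.add_apply, add_mul, mul_add, hx g h y hy, hx' g h y hy]
  algebraMap_mem' c g h y _ := by
    simpa using Algebra.commutes c y

/-- The action of `l : G` on the `G`-centre: `x` is sent to `g ↦ x (l + g)`. -/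
def gCentreAct (l : G) (x : gCentre 𝒜) : gCentre 𝒜 :=
  ⟨fun g => x.1 (l + g), fun g h y hy => by
    have := x.2 (l + g) h y hy
    rwa [add_assoc] at this⟩

/-- The component of degree `g : G` of the `G`-centre. -/
def gCentreDeg (g : G) : Submodule k (gCentre 𝒜) where
  carrier := {x | ∀ l, x.1 l ∈ 𝒜 g}
  zero_mem' _ := (𝒜 g).zero_mem
  add_mem' hx hy l := (𝒜 g).add_mem (hx l) (hy l)
  smul_mem' c _ hx l := (𝒜 g).smul_mem c (hx l)

/-- The component of degree `χ : G → kˣ` of the `G`-centre. -/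
def gCentreChar (χ : AddChar G kˣ) : Submodule k (gCentre 𝒜) where
  carrier := {x | ∀ l, x.1 l = (χ l : k) • x.1 0}
  zero_mem' _ := (smul_zero _).symm
  add_mem' {x y} hx hy l := by
    change x.1 l + y.1 l = (χ l : k) • (x.1 0 + y.1 0)
    rw [smul_add, ← hx l, ← hy l]
  smul_mem' c x hx l := by
    change c • x.1 l = (χ l : k) • c • x.1 0
    rw [smul_comm, ← hx l]

/-- The component of degree `(g, χ)` of the `G`-centre. -/
def gCentreBideg (g : G) (χ : AddChar G kˣ) : Submodule k (gCentre 𝒜) :=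
  gCentreDeg 𝒜 g ⊓ gCentreChar 𝒜 χ

end

end GCentre

end

/-! A homogeneous element `x` of the `G`-centre of degree `g` is the same thing as a natural family
of maps `M ⟶ Π_g M`: multiply the component of degree `h` by `x (-h)`. Such a family is determined
by its values on the shifted regular modules `Π_h A`, and any family on these that is natural for
the maps between them comes from the `G`-centre (`exists_act_free`). The action extends to complexes
and to the derived category, where products and translates become composition and conjugation by the
functors `Π_l`.

A graded equivalence `F` has invertible `ξ^g`, so the action of `y` on `X` can be compared with that
of `x` on `F X`; this is the relation `ActsAlike`. Each `x` over `B` has exactly one `y` over `A`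
that acts alike on all `Π_h A` in degree `0` (`exists_actsAlike_free`, `actsAlike_left_unique`), and
the relation then holds on every module in degree `0` (`ActsAlike.single`), because shifted regular
modules generate.

The converse needs the condition on one degree. The maps `ξ^g` are not assumed compatible with the
triangulated shift, so `ActsAlike` cannot simply be moved between cohomological degrees; vanishing
of the action can. Write `F⁻¹ B = N` in degree `n`. If `x` kills `F (Π_h A)`, shifting shows that
`0` and `x` act alike on free modules in degree `n`, hence on `Π_h N` there, which `F` sends to `Π_h
B`; so `x = 0` (`eq_zero_of_dApp_map_free`). Given `y`, its action on `Π_h N` in degree `0` yields a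
candidate `x`, and the same vanishing argument for `F⁻¹` shows that `y` is the partner of `x`
(`exists_actsAlike_of_centre`). Since `ActsAlike` respects sums, scalars, units, products and
translates, the bijection has all the required properties; characters are preserved because they are
read off from the action of `G`. -/

noncomputable section

open CategoryTheory CategoryTheory.Limits

universe u v v' w

namespace GCentre

variable {k : Type u} [Field k] {G : Type w} [DecidableEq G] [AddCommGroup G]
  {A : Type v} [Ring A] [Algebra k A] {B : Type v'} [Ring B] [Algebra k B]

/-! ### The action of the `G`-centre on graded modules -/

namespace GMod

variable {𝒜 : G → Submodule k A}

lemma linearMap_ext_deg (M : GMod 𝒜) {V : Type*} [AddCommGroup V] [Module k V]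
    {f f' : M →ₗ[k] V} (h : ∀ (g : G) (v : M), v ∈ M.deg g → f v = f' v) : f = f' := by
  have : ⊤ ≤ LinearMap.eqLocus f f' := by
    rw [← M.iSup_deg]
    exact iSup_le fun g v hv => h g v hv
  exact LinearMap.ext fun v => this (Submodule.mem_top (x := v))

lemma hom_ext_deg {M N : GMod 𝒜} {f f' : M ⟶ N}
    (h : ∀ (g : G) (v : M), v ∈ M.deg g → lin f v = lin f' v) : f = f' :=
  hom_ext fun v => LinearMap.congr_fun (linearMap_ext_deg M (f := klin f) (f' := klin f') h) v

/-- The linear map which multiplies the component of degree `h` by `x (-h)`. -/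
def homogMul (x : G → A) (M : GMod 𝒜) : M →ₗ[k] M :=
  DirectSum.toModule k G M (fun h => (Algebra.lsmul k k M (x (-h))) ∘ₗ (M.deg h).subtype) ∘ₗ
    M.decomp.symm.toLinearMap

lemma homogMul_of_mem (x : G → A) (M : GMod 𝒜) {h : G} {v : M} (hv : v ∈ M.deg h) :
    homogMul x M v = x (-h) • v := by
  simp [homogMul, decomp_symm M hv]

/-- This forces the index `-h`: if `a` has degree `i`, then `a • v` lies in degree `h + i`, and the
centre relation at `-(h + i)` reads `x (-(h + i)) * a = a * x (-h)`. -/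
lemma homogMul_smul [GradedAlgebra 𝒜] (x : gCentre 𝒜) (M : GMod 𝒜) (a : A) (v : M) :
    homogMul x.1 M (a • v) = a • homogMul x.1 M v := by
  induction a using DirectSum.Decomposition.inductionOn 𝒜 with
  | zero => simp
  | add a b ha hb => simp [add_smul, ha, hb]
  | @homogeneous i a =>
    have : homogMul x.1 M ∘ₗ Algebra.lsmul k k M a.1 =
        Algebra.lsmul k k M a.1 ∘ₗ homogMul x.1 M := by
      refine linearMap_ext_deg M fun h v hv => ?_
      have hx := x.2 (-(h + i)) i a.1 a.2
      rw [neg_add, neg_add_cancel_right] at hx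
      simp only [LinearMap.comp_apply, Algebra.lsmul_coe]
      rw [homogMul_of_mem _ M hv, homogMul_of_mem _ M (M.smul_mem a.2 hv), smul_smul, smul_smul,
        neg_add, hx]
    exact LinearMap.congr_fun this v

/-- The natural transformation `Id ⟶ Π_g` given by a homogeneous element of the `G`-centre. -/
def act [GradedAlgebra 𝒜] {g : G} (x : gCentreDeg 𝒜 g) : 𝟭 (GMod 𝒜) ⟶ shift 𝒜 g where
  app M := ofLin (M := M) (N := shiftObj g M)
    { toFun := homogMul x.1.1 M
      map_add' := map_add _
      map_smul' := homogMul_smul x.1 M }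
    (fun h v hv => by
      change homogMul x.1.1 M v ∈ M.deg (h + g)
      rw [homogMul_of_mem _ M hv]
      exact M.smul_mem (x.2 _) hv)
  naturality M N f := by
    have : homogMul x.1.1 N ∘ₗ klin f = klin f ∘ₗ homogMul x.1.1 M := by
      refine linearMap_ext_deg M fun h v hv => ?_
      simp only [LinearMap.comp_apply, klin_apply]
      rw [homogMul_of_mem _ M hv, homogMul_of_mem _ N (lin_mem f hv), map_smul]
    exact hom_ext fun v => LinearMap.congr_fun this v

section

variable [GradedAlgebra 𝒜]

lemma lin_act_apply {g : G} (x : gCentreDeg 𝒜 g) (M : GMod 𝒜) {h : G} {v : M}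
    (hv : v ∈ M.deg h) : lin ((act x).app M) v = x.1.1 (-h) • v :=
  homogMul_of_mem _ M hv

lemma act_add {g : G} (x y : gCentreDeg 𝒜 g) (M : GMod 𝒜) :
    (act (x + y)).app M = (act x).app M + (act y).app M := by
  have : homogMul (x + y).1.1 M = homogMul x.1.1 M + homogMul y.1.1 M :=
    linearMap_ext_deg M fun h v hv => by
      rw [LinearMap.add_apply, homogMul_of_mem _ _ hv, homogMul_of_mem _ _ hv,
        homogMul_of_mem _ _ hv]
      exact add_smul _ _ _
  exact hom_ext fun v => LinearMap.congr_fun this v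

lemma act_smul {g : G} (c : k) (x : gCentreDeg 𝒜 g) (M : GMod 𝒜) :
    (act (c • x)).app M = c • (act x).app M := by
  have : homogMul (c • x).1.1 M = c • homogMul x.1.1 M :=
    linearMap_ext_deg M fun h v hv => by
      rw [LinearMap.smul_apply, homogMul_of_mem _ _ hv, homogMul_of_mem _ _ hv]
      exact smul_assoc _ _ _
  exact hom_ext fun v => LinearMap.congr_fun this v

/-- The unit of the `G`-centre, as an element of degree zero. -/
def oneDeg (𝒜 : G → Submodule k A) [GradedAlgebra 𝒜] : gCentreDeg 𝒜 (0 : G) :=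
  ⟨1, fun _ => SetLike.one_mem_graded 𝒜⟩

/-- The product of homogeneous elements of the `G`-centre. -/
def mulDeg {g h : G} (x : gCentreDeg 𝒜 g) (y : gCentreDeg 𝒜 h) : gCentreDeg 𝒜 (g + h) :=
  ⟨x.1 * y.1, fun l => SetLike.mul_mem_graded (x.2 l) (y.2 l)⟩

/-- The action of `G` on homogeneous elements of the `G`-centre. -/
def translateDeg (l : G) {g : G} (x : gCentreDeg 𝒜 g) : gCentreDeg 𝒜 g :=
  ⟨gCentreAct 𝒜 l x.1, fun i => x.2 (l + i)⟩

lemma act_one (M : GMod 𝒜) :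
    (act (oneDeg 𝒜)).app M ≫ (shiftZero 𝒜).hom.app M = 𝟙 M := by
  have : homogMul (oneDeg 𝒜).1.1 M = LinearMap.id :=
    linearMap_ext_deg M fun h v hv => by
      rw [homogMul_of_mem _ _ hv]
      exact one_smul A v
  exact hom_ext fun v => LinearMap.congr_fun this v

/-- Applying `y` moves degree `i` of `M` to degree `i` of `Π_h M`, so both factors are evaluated at
the same index `-i`; hence the pointwise product. -/
lemma act_mul {g h : G} (x : gCentreDeg 𝒜 g) (y : gCentreDeg 𝒜 h) (M : GMod 𝒜) :
    (act (mulDeg x y)).app M ≫ (shiftAdd 𝒜 g h).hom.app M =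
      (act y).app M ≫ (act x).app ((shift 𝒜 h).obj M) := by
  have : homogMul (mulDeg x y).1.1 M =
      (homogMul x.1.1 ((shift 𝒜 h).obj M) : M →ₗ[k] M) ∘ₗ homogMul y.1.1 M :=
    linearMap_ext_deg M fun i v hv => by
      have hy : homogMul y.1.1 M v ∈ ((shift 𝒜 h).obj M).deg i := lin_mem ((act y).app M) hv
      refine Eq.trans ?_ (homogMul_of_mem x.1.1 ((shift 𝒜 h).obj M) hy).symm
      rw [homogMul_of_mem _ _ hv, homogMul_of_mem _ _ hv]
      exact mul_smul (x.1.1 (-i)) (y.1.1 (-i)) v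
  exact hom_ext fun v => LinearMap.congr_fun this v

/-- Degree `h` of `M` is degree `h - l` of `Π_l M`, so there `x` is evaluated at `l - h`, which is
the translate by `l` evaluated at `-h`. -/
lemma act_translate {g : G} (l : G) (x : gCentreDeg 𝒜 g) (M : GMod 𝒜) (v : M) :
    lin ((shift 𝒜 l).map ((act (translateDeg l x)).app M)) v =
      lin ((act x).app ((shift 𝒜 l).obj M)) v := by
  suffices h : homogMul (translateDeg l x).1.1 M = homogMul x.1.1 ((shift 𝒜 l).obj M) from
    LinearMap.congr_fun h v
  refine linearMap_ext_deg M fun h v hv => ?_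
  have hv' : v ∈ ((shift 𝒜 l).obj M).deg (h - l) := by
    change v ∈ M.deg (h - l + l)
    rwa [sub_add_cancel]
  refine (homogMul_of_mem _ M hv).trans ((homogMul_of_mem _ _ hv').trans ?_).symm
  change x.1.1 (-(h - l)) • v = x.1.1 (l + -h) • v
  rw [neg_sub, sub_eq_add_neg]

end

/-! ### Shifted regular modules determine the `G`-centre -/

section

variable (𝒜) [GradedAlgebra 𝒜] [Module.Finite k A]

/-- The shifted regular module `Π_h A`. -/
abbrev free (h : G) : GMod 𝒜 := (shift 𝒜 h).obj (regular 𝒜)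

/-- The unit of the algebra as an element of a shifted regular module. -/
def freeOne (h : G) : free 𝒜 h := (1 : A)

lemma freeOne_mem (h : G) : freeOne 𝒜 h ∈ (free 𝒜 h).deg (-h) := by
  change (1 : A) ∈ 𝒜 (-h + h)
  rw [neg_add_cancel]
  exact SetLike.one_mem_graded 𝒜

variable {𝒜}

lemma free_hom_ext {h : G} {M : GMod 𝒜} {f f' : free 𝒜 h ⟶ M}
    (hf : lin f (freeOne 𝒜 h) = lin f' (freeOne 𝒜 h)) : f = f' := by
  refine hom_ext fun v => ?_
  have hv : v = (show A from v) • freeOne 𝒜 h := (mul_one (show A from v)).symm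
  rw [hv, map_smul, map_smul, hf]

/-- The morphism from a shifted regular module given by a homogeneous element. -/
def freeLift {M : GMod 𝒜} {h : G} (v : M) (hv : v ∈ M.deg (-h)) : free 𝒜 h ⟶ M :=
  ofLin (M := free 𝒜 h) (LinearMap.toSpanSingleton A M v) fun l a ha => by
    have := M.smul_mem (g := l + h) (a := (show A from a)) ha hv
    rwa [add_comm l h, neg_add_cancel_left] at this

/-- A homogeneous element of degree `i` is the image of the generator of `Π_{-i} A`, so shifted
regular modules generate. -/
lemma eq_zero_of_free_comp {M N : GMod 𝒜} (ε : M ⟶ N)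
    (h : ∀ (h : G) (f : free 𝒜 h ⟶ M), f ≫ ε = 0) : ε = 0 :=
  hom_ext_deg fun i v hv => by
    have hv' : v ∈ M.deg (- -i) := by rwa [neg_neg]
    have := LinearMap.congr_fun (congrArg lin (h (-i) (freeLift v hv'))) (freeOne 𝒜 (-i))
    refine Eq.trans ?_ this
    exact congrArg (lin ε) (one_smul A v).symm

/-- The generator of `Π_h A` has degree `-h`, so the action on it reads off the value of `x` at `h`.
-/
lemma lin_act_freeOne {g : G} (x : gCentreDeg 𝒜 g) (h : G) :
    lin ((act x).app (free 𝒜 h)) (freeOne 𝒜 h) = x.1.1 h := by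
  refine (lin_act_apply x _ (freeOne_mem 𝒜 h)).trans ?_
  rw [neg_neg]
  exact mul_one (x.1.1 h)

lemma eq_of_act_free {g : G} {x y : gCentreDeg 𝒜 g}
    (h : ∀ h : G, (act x).app (free 𝒜 h) = (act y).app (free 𝒜 h)) : x = y := by
  refine Subtype.ext (Subtype.ext (funext fun l => ?_))
  rw [← lin_act_freeOne, ← lin_act_freeOne, h]

/-- A Yoneda argument: `η h` is determined by its value `y h` on the generator, and naturality for
right multiplication by `a` of degree `i`, as a map `Π_h A ⟶ Π_{h + i} A`, is exactly the centre
relation for `y`. -/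
lemma exists_act_free {g : G} (η : ∀ h : G, free 𝒜 h ⟶ (shift 𝒜 g).obj (free 𝒜 h))
    (hη : ∀ (h h' : G) (f : free 𝒜 h ⟶ free 𝒜 h'), f ≫ η h' = η h ≫ (shift 𝒜 g).map f) :
    ∃ x : gCentreDeg 𝒜 g, ∀ h, (act x).app (free 𝒜 h) = η h := by
  let y : G → A := fun h => lin (η h) (freeOne 𝒜 h)
  have hy : ∀ (h i : G) (a : A), a ∈ 𝒜 i → y h * a = a * y (h + i) := by
    intro h i a ha
    have ha' : (show free 𝒜 (h + i) from a) ∈ (free 𝒜 (h + i)).deg (-h) := by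
      change a ∈ 𝒜 (-h + (h + i))
      rwa [neg_add_cancel_left]
    have := LinearMap.congr_fun (congrArg lin (hη h (h + i) (freeLift _ ha'))) (freeOne 𝒜 h)
    rw [lin_comp, lin_comp, LinearMap.comp_apply, LinearMap.comp_apply] at this
    have e₁ : lin (freeLift _ ha') (freeOne 𝒜 h) = a • freeOne 𝒜 (h + i) :=
      (one_mul a).trans (mul_one a).symm
    rw [e₁, map_smul] at this
    exact this.symm
  refine ⟨⟨⟨y, hy⟩, fun h => ?_⟩, fun h => free_hom_ext (lin_act_freeOne _ h)⟩
  have := lin_mem (η h) (freeOne_mem 𝒜 h)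
  change y h ∈ 𝒜 (-h + g + h) at this
  rwa [neg_add_cancel_comm] at this

end

end GMod

/-! ### Extension of the action to the derived category -/

section

open GMod

variable {𝒜 : G → Submodule k A}

lemma derShiftZero_hom_app_Q (K : CochainComplex (GMod 𝒜) ℤ) :
    (derShiftZero 𝒜).hom.app (DerivedCategory.Q.obj K) =
      (GMod.shift 𝒜 0).mapDerivedCategoryFactors.hom.app K ≫
        DerivedCategory.Q.map ((cShiftZero 𝒜).hom.app K) := by
  refine (Localization.liftNatTrans_app DerivedCategory.Q
    (HomologicalComplex.quasiIso (GMod 𝒜) (ComplexShape.up ℤ))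
    ((GMod.shift 𝒜 0).mapHomologicalComplex (ComplexShape.up ℤ) ⋙ DerivedCategory.Q)
    DerivedCategory.Q _ _ _ K).trans ?_
  simp
  rfl

lemma derShiftAdd_hom_app_Q (g h : G) (K : CochainComplex (GMod 𝒜) ℤ) :
    (derShiftAdd 𝒜 g h).hom.app (DerivedCategory.Q.obj K) =
      (GMod.shift 𝒜 (g + h)).mapDerivedCategoryFactors.hom.app K ≫
        DerivedCategory.Q.map ((cShiftAdd 𝒜 g h).hom.app K) ≫
        (GMod.shift 𝒜 g).mapDerivedCategoryFactors.inv.app _ ≫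
        (GMod.shift 𝒜 g).mapDerivedCategory.map
          ((GMod.shift 𝒜 h).mapDerivedCategoryFactors.inv.app K) := by
  let _ := compLifting 𝒜 g h
  refine (Localization.liftNatTrans_app DerivedCategory.Q
    (HomologicalComplex.quasiIso (GMod 𝒜) (ComplexShape.up ℤ))
    ((GMod.shift 𝒜 (g + h)).mapHomologicalComplex (ComplexShape.up ℤ) ⋙ DerivedCategory.Q)
    (((GMod.shift 𝒜 h).mapHomologicalComplex (ComplexShape.up ℤ) ⋙
        (GMod.shift 𝒜 g).mapHomologicalComplex (ComplexShape.up ℤ)) ⋙ DerivedCategory.Q)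
    _ _ _ K).trans ?_
  simp [Localization.Lifting.iso]

lemma derShiftAdd_inv_app_Q (g h : G) (K : CochainComplex (GMod 𝒜) ℤ) :
    (derShiftAdd 𝒜 g h).inv.app (DerivedCategory.Q.obj K) =
      (GMod.shift 𝒜 g).mapDerivedCategory.map
          ((GMod.shift 𝒜 h).mapDerivedCategoryFactors.hom.app K) ≫
        (GMod.shift 𝒜 g).mapDerivedCategoryFactors.hom.app _ ≫
        DerivedCategory.Q.map ((cShiftAdd 𝒜 g h).inv.app K) ≫
        (GMod.shift 𝒜 (g + h)).mapDerivedCategoryFactors.inv.app K := by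
  rw [← cancel_epi ((derShiftAdd 𝒜 g h).hom.app _), Iso.hom_inv_id_app, derShiftAdd_hom_app_Q]
  simp only [Category.assoc]
  rw [← Functor.map_comp_assoc, Iso.inv_hom_id_app]
  erw [CategoryTheory.Functor.map_id, Category.id_comp]
  rw [Iso.inv_hom_id_app_assoc, ← Functor.map_comp_assoc, Iso.hom_inv_id_app]
  erw [CategoryTheory.Functor.map_id, Category.id_comp]
  rw [Iso.hom_inv_id_app]
  rfl

/-- The isomorphism `Π_s ≅ Π_g ∘ Π_h` on the derived category when `g + h = s`. -/
def derShiftAdd' (𝒜 : G → Submodule k A) (g h s : G) (hs : g + h = s) :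
    (GMod.shift 𝒜 s).mapDerivedCategory ≅
      (GMod.shift 𝒜 h).mapDerivedCategory ⋙ (GMod.shift 𝒜 g).mapDerivedCategory :=
  eqToIso (by rw [hs]) ≪≫ derShiftAdd 𝒜 g h

/-- The isomorphism `Π_s ≅ Π_g ∘ Π_h` on complexes when `g + h = s`. -/
def cShiftAdd' (𝒜 : G → Submodule k A) (g h s : G) (hs : g + h = s) :
    (GMod.shift 𝒜 s).mapHomologicalComplex (ComplexShape.up ℤ) ≅
      (GMod.shift 𝒜 h).mapHomologicalComplex (ComplexShape.up ℤ) ⋙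
        (GMod.shift 𝒜 g).mapHomologicalComplex (ComplexShape.up ℤ) :=
  eqToIso (by rw [hs]) ≪≫ cShiftAdd 𝒜 g h

lemma derShiftAdd'_inv_app_Q (g h s : G) (hs : g + h = s) (K : CochainComplex (GMod 𝒜) ℤ) :
    (derShiftAdd' 𝒜 g h s hs).inv.app (DerivedCategory.Q.obj K) =
      (GMod.shift 𝒜 g).mapDerivedCategory.map
          ((GMod.shift 𝒜 h).mapDerivedCategoryFactors.hom.app K) ≫
        (GMod.shift 𝒜 g).mapDerivedCategoryFactors.hom.app _ ≫
        DerivedCategory.Q.map ((cShiftAdd' 𝒜 g h s hs).inv.app K) ≫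
        (GMod.shift 𝒜 s).mapDerivedCategoryFactors.inv.app K := by
  subst hs
  simp only [derShiftAdd', cShiftAdd', eqToIso_refl, Iso.refl_trans, derShiftAdd_inv_app_Q]

/-- Transport along `g + h = s` does not touch underlying maps, so the decompositions `l + g` and `g
+ l` of one `s` can be compared elementwise. -/
lemma lin_cShiftAdd'_inv (g h s : G) (hs : g + h = s) (K : CochainComplex (GMod 𝒜) ℤ) (i : ℤ)
    (v : K.X i) : lin (((cShiftAdd' 𝒜 g h s hs).inv.app K).f i) v = v := by
  subst hs
  simp only [cShiftAdd', eqToIso_refl, Iso.refl_trans]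
  rfl

/-- Since `Q` is a localization functor, identities of natural transformations need checking only on
images of complexes, and there they reduce to module identities in each degree. -/
lemma natTrans_app_ext_of_Q {D : Type*} [Category* D] {F F' : DerivedCategory (GMod 𝒜) ⥤ D}
    (τ τ' : F ⟶ F') (h : ∀ K : CochainComplex (GMod 𝒜) ℤ,
      τ.app (DerivedCategory.Q.obj K) = τ'.app (DerivedCategory.Q.obj K)) (X) :
    τ.app X = τ'.app X := by
  rw [Localization.natTrans_ext DerivedCategory.Q
    (HomologicalComplex.quasiIso (GMod 𝒜) (ComplexShape.up ℤ)) h]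

variable [GradedAlgebra 𝒜]

/-- The action of a homogeneous element of the `G`-centre on complexes. -/
def cAct {g : G} (x : gCentreDeg 𝒜 g) :
    𝟭 (CochainComplex (GMod 𝒜) ℤ) ⟶
      (GMod.shift 𝒜 g).mapHomologicalComplex (ComplexShape.up ℤ) where
  app K :=
    { f := fun i => (act x).app (K.X i)
      comm' := fun i j _ => ((act x).naturality (K.d i j)).symm }
  naturality K L f := by
    ext i
    exact (act x).naturality (f.f i)

/-- The action of a homogeneous element of the `G`-centre on the derived category. -/
def derAct {g : G} (x : gCentreDeg 𝒜 g) :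
    𝟭 (DerivedCategory (GMod 𝒜)) ⟶ (GMod.shift 𝒜 g).mapDerivedCategory :=
  Localization.liftNatTrans DerivedCategory.Q
    (HomologicalComplex.quasiIso (GMod 𝒜) (ComplexShape.up ℤ)) DerivedCategory.Q
    ((GMod.shift 𝒜 g).mapHomologicalComplex (ComplexShape.up ℤ) ⋙ DerivedCategory.Q) _ _
    ((Functor.leftUnitor _).inv ≫ Functor.whiskerRight (cAct x) DerivedCategory.Q)

/-- The components of `cAct`. -/
def cApp {g : G} (x : gCentreDeg 𝒜 g) (K : CochainComplex (GMod 𝒜) ℤ) :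
    K ⟶ ((GMod.shift 𝒜 g).mapHomologicalComplex (ComplexShape.up ℤ)).obj K :=
  (cAct x).app K

/-- The components of `derAct`. -/
def derApp {g : G} (x : gCentreDeg 𝒜 g) (X : DerivedCategory (GMod 𝒜)) :
    X ⟶ (GMod.shift 𝒜 g).mapDerivedCategory.obj X :=
  (derAct x).app X

lemma derApp_naturality {g : G} (x : gCentreDeg 𝒜 g) {X Y : DerivedCategory (GMod 𝒜)}
    (f : X ⟶ Y) :
    f ≫ derApp x Y = derApp x X ≫ (GMod.shift 𝒜 g).mapDerivedCategory.map f :=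
  (derAct x).naturality f

lemma derApp_Q {g : G} (x : gCentreDeg 𝒜 g) (K : CochainComplex (GMod 𝒜) ℤ) :
    derApp x (DerivedCategory.Q.obj K) =
      DerivedCategory.Q.map (cApp x K) ≫
        (GMod.shift 𝒜 g).mapDerivedCategoryFactors.inv.app K := by
  have := Localization.liftNatTrans_app DerivedCategory.Q
    (HomologicalComplex.quasiIso (GMod 𝒜) (ComplexShape.up ℤ)) DerivedCategory.Q
    ((GMod.shift 𝒜 g).mapHomologicalComplex (ComplexShape.up ℤ) ⋙ DerivedCategory.Q)
    (𝟭 _) ((GMod.shift 𝒜 g).mapDerivedCategory)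
    ((Functor.leftUnitor _).inv ≫ Functor.whiskerRight (cAct x) DerivedCategory.Q) K
  refine this.trans ?_
  simp
  rfl

lemma derApp_add {g : G} (x y : gCentreDeg 𝒜 g) (X : DerivedCategory (GMod 𝒜)) :
    derApp (x + y) X = derApp x X + derApp y X := by
  refine natTrans_app_ext_of_Q (derAct (x + y)) (derAct x + derAct y) (fun K => ?_) X
  change derApp (x + y) (DerivedCategory.Q.obj K) =
    derApp x (DerivedCategory.Q.obj K) + derApp y (DerivedCategory.Q.obj K)
  have : cApp (x + y) K = cApp x K + cApp y K := by
    ext i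
    exact act_add x y (K.X i)
  rw [derApp_Q, derApp_Q, derApp_Q, this, Functor.map_add, Preadditive.add_comp]

lemma derApp_smul {g : G} (c : k) (x : gCentreDeg 𝒜 g) (X : DerivedCategory (GMod 𝒜)) :
    derApp (c • x) X = c • derApp x X := by
  refine natTrans_app_ext_of_Q (derAct (c • x)) (c • derAct x) (fun K => ?_) X
  change derApp (c • x) (DerivedCategory.Q.obj K) = c • derApp x (DerivedCategory.Q.obj K)
  have : cApp (c • x) K = c • cApp x K := by
    ext i
    exact act_smul c x (K.X i)
  rw [derApp_Q, derApp_Q, this, Functor.map_smul, Linear.smul_comp]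

lemma derApp_one (X : DerivedCategory (GMod 𝒜)) :
    derApp (oneDeg 𝒜) X ≫ (derShiftZero 𝒜).hom.app X = 𝟙 X := by
  refine natTrans_app_ext_of_Q (derAct (oneDeg 𝒜) ≫ (derShiftZero 𝒜).hom) (𝟙 (𝟭 _))
    (fun K => ?_) X
  change derApp (oneDeg 𝒜) _ ≫ (derShiftZero 𝒜).hom.app _ = 𝟙 (DerivedCategory.Q.obj K)
  have : cApp (oneDeg 𝒜) K ≫ (cShiftZero 𝒜).hom.app K = 𝟙 K := by
    ext i
    exact act_one (K.X i)
  rw [derApp_Q, derShiftZero_hom_app_Q, Category.assoc, Iso.inv_hom_id_app_assoc,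
    ← Functor.map_comp, this]
  exact CategoryTheory.Functor.map_id _ K

lemma derApp_mul {g h : G} (x : gCentreDeg 𝒜 g) (y : gCentreDeg 𝒜 h)
    (X : DerivedCategory (GMod 𝒜)) :
    derApp (mulDeg x y) X ≫ (derShiftAdd 𝒜 g h).hom.app X =
      derApp y X ≫ derApp x ((GMod.shift 𝒜 h).mapDerivedCategory.obj X) := by
  let τ : 𝟭 (DerivedCategory (GMod 𝒜)) ⟶
      (GMod.shift 𝒜 h).mapDerivedCategory ⋙ (GMod.shift 𝒜 g).mapDerivedCategory :=
    derAct y ≫ (Functor.rightUnitor _).inv ≫ Functor.whiskerLeft _ (derAct x)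
  have hτ : ∀ X, τ.app X = derApp y X ≫ derApp x _ := fun X => by
    simp only [τ, NatTrans.comp_app, Functor.whiskerLeft_app, Functor.rightUnitor_inv_app,
      Category.id_comp]
    rfl
  refine (natTrans_app_ext_of_Q (derAct (mulDeg x y) ≫ (derShiftAdd 𝒜 g h).hom) τ
    (fun K => Eq.trans ?_ (hτ _).symm) X).trans (hτ X)
  change derApp (mulDeg x y) (DerivedCategory.Q.obj K) ≫ (derShiftAdd 𝒜 g h).hom.app _ =
    derApp y (DerivedCategory.Q.obj K) ≫ derApp x _
  have : cApp (mulDeg x y) K ≫ (cShiftAdd 𝒜 g h).hom.app K = cApp y K ≫ cApp x _ := by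
    ext i
    exact act_mul x y (K.X i)
  have nat := derApp_naturality x ((GMod.shift 𝒜 h).mapDerivedCategoryFactors.inv.app K)
  simp only [Functor.comp_obj] at nat
  rw [derApp_Q, derApp_Q, derShiftAdd_hom_app_Q, Category.assoc, Category.assoc, nat, derApp_Q,
    Iso.inv_hom_id_app_assoc, ← Functor.map_comp_assoc, this, Functor.map_comp_assoc,
    Category.assoc]

/-- Both composites end in `Π_s`, so that `Π_l Π_g` and `Π_g Π_l` are compared through one functor.
After the comparison isomorphisms with `Q` are cancelled, only `act_translate` in each degree
remains. -/
lemma derApp_translate {g : G} (l s : G) (hs : l + g = s) (hs' : g + l = s)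
    (x : gCentreDeg 𝒜 g) (X : DerivedCategory (GMod 𝒜)) :
    (GMod.shift 𝒜 l).mapDerivedCategory.map (derApp (translateDeg l x) X) ≫
        (derShiftAdd' 𝒜 l g s hs).inv.app X =
      derApp x ((GMod.shift 𝒜 l).mapDerivedCategory.obj X) ≫
        (derShiftAdd' 𝒜 g l s hs').inv.app X := by
  let τ : (GMod.shift 𝒜 l).mapDerivedCategory ⟶ (GMod.shift 𝒜 s).mapDerivedCategory :=
    (Functor.leftUnitor _).inv ≫ Functor.whiskerRight (derAct (translateDeg l x)) _ ≫
      (derShiftAdd' 𝒜 l g s hs).inv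
  let τ' : (GMod.shift 𝒜 l).mapDerivedCategory ⟶ (GMod.shift 𝒜 s).mapDerivedCategory :=
    (Functor.rightUnitor _).inv ≫ Functor.whiskerLeft _ (derAct x) ≫
      (derShiftAdd' 𝒜 g l s hs').inv
  have hτ : ∀ X, τ.app X = (GMod.shift 𝒜 l).mapDerivedCategory.map
      (derApp (translateDeg l x) X) ≫ (derShiftAdd' 𝒜 l g s hs).inv.app X := fun X => by
    simp only [τ, NatTrans.comp_app, Functor.whiskerRight_app, Functor.leftUnitor_inv_app,
      Category.id_comp]
    rfl
  have hτ' : ∀ X, τ'.app X = derApp x ((GMod.shift 𝒜 l).mapDerivedCategory.obj X) ≫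
        (derShiftAdd' 𝒜 g l s hs').inv.app X := fun X => by
    simp only [τ', NatTrans.comp_app, Functor.whiskerLeft_app, Functor.rightUnitor_inv_app,
      Category.id_comp]
    rfl
  rw [← hτ, ← hτ']
  refine natTrans_app_ext_of_Q τ τ' (fun K => ?_) X
  rw [hτ, hτ']
  have key : ((GMod.shift 𝒜 l).mapHomologicalComplex (ComplexShape.up ℤ)).map
        (cApp (translateDeg l x) K) ≫ (cShiftAdd' 𝒜 l g s hs).inv.app K =
      cApp x _ ≫ (cShiftAdd' 𝒜 g l s hs').inv.app K := by
    ext i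
    refine hom_ext fun v => ?_
    exact (lin_cShiftAdd'_inv l g s hs K i _).trans
      ((act_translate l x (K.X i) v).trans (lin_cShiftAdd'_inv g l s hs' K i _).symm)
  have nat := derApp_naturality x ((GMod.shift 𝒜 l).mapDerivedCategoryFactors.hom.app K)
  simp only [Functor.comp_obj] at nat
  have nat' := (GMod.shift 𝒜 l).mapDerivedCategoryFactors.hom.naturality
    (cApp (translateDeg l x) K)
  simp only [Functor.comp_map] at nat'
  have canc : (GMod.shift 𝒜 l).mapDerivedCategory.map
        (derApp (translateDeg l x) (DerivedCategory.Q.obj K)) ≫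
      (GMod.shift 𝒜 l).mapDerivedCategory.map
        ((GMod.shift 𝒜 g).mapDerivedCategoryFactors.hom.app K) =
      (GMod.shift 𝒜 l).mapDerivedCategory.map
        (DerivedCategory.Q.map (cApp (translateDeg l x) K)) := by
    rw [← Functor.map_comp, derApp_Q, Category.assoc, Iso.inv_hom_id_app]
    exact congrArg _ (Category.comp_id _)
  rw [derShiftAdd'_inv_app_Q, derShiftAdd'_inv_app_Q, reassoc_of% canc, reassoc_of% nat',
    ← reassoc_of% nat, derApp_Q, Category.assoc, Iso.inv_hom_id_app_assoc,
    ← Functor.map_comp_assoc, key, Functor.map_comp_assoc]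

end

/-! ### The action on the bounded derived category and on modules placed in one degree -/

section

open GMod

variable (𝒜 : G → Submodule k A)

/-- The embedding of the category of graded modules in the bounded derived category, in
cohomological degree `j`. -/
def singleF (j : ℤ) : GMod 𝒜 ⥤ Db 𝒜 :=
  DerivedCategory.TStructure.t.bounded.lift (DerivedCategory.singleFunctor (GMod 𝒜) j)
    (fun M => (single 𝒜 j M).property)

instance (j : ℤ) : (singleF 𝒜 j).Full where
  map_surjective f := by
    obtain ⟨f', hf'⟩ := (DerivedCategory.singleFunctor (GMod 𝒜) j).map_surjective f.hom
    exact ⟨f', ObjectProperty.hom_ext _ hf'⟩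

instance (j : ℤ) : (singleF 𝒜 j).Faithful where
  map_injective h := (DerivedCategory.singleFunctor (GMod 𝒜) j).map_injective
    (congrArg (DerivedCategory.Bounded.ι (C := GMod 𝒜)).map h)

instance (j : ℤ) : (singleF 𝒜 j).Additive where
  map_add {_ _ f₁ f₂} := ObjectProperty.hom_ext _
    ((DerivedCategory.singleFunctor (GMod 𝒜) j).map_add (f := f₁) (g := f₂))

/-- `Π_g` commutes with the embedding of graded modules in the derived category. -/
def dShiftSingle (g : G) (j : ℤ) (M : GMod 𝒜) :
    (dShift 𝒜 g).obj ((singleF 𝒜 j).obj M) ≅ (singleF 𝒜 j).obj ((GMod.shift 𝒜 g).obj M) :=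
  ObjectProperty.isoMk _
    ((GMod.shift 𝒜 g).mapDerivedCategoryFactors.app _ ≪≫ DerivedCategory.Q.mapIso
      ((HomologicalComplex.singleMapHomologicalComplex (GMod.shift 𝒜 g)
        (ComplexShape.up ℤ) j).app M))

/-- The embeddings in different cohomological degrees differ by a shift. -/
def singleShift (n a a' : ℤ) (h : n + a = a') (M : GMod 𝒜) :
    ((singleF 𝒜 a').obj M)⟦n⟧ ≅ (singleF 𝒜 a).obj M :=
  ObjectProperty.isoMk _ (((DerivedCategory.Bounded.ι (C := GMod 𝒜)).commShiftIso n).app _ ≪≫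
    ((DerivedCategory.singleFunctors (GMod 𝒜)).shiftIso n a a' h).app M)

variable {𝒜}

lemma dShiftSingle_naturality (g : G) (j : ℤ) {M N : GMod 𝒜} (f : M ⟶ N) :
    (dShift 𝒜 g).map ((singleF 𝒜 j).map f) ≫ (dShiftSingle 𝒜 g j N).hom =
      (dShiftSingle 𝒜 g j M).hom ≫ (singleF 𝒜 j).map ((GMod.shift 𝒜 g).map f) := by
  refine ObjectProperty.hom_ext _ ?_
  let S := HomologicalComplex.single (GMod 𝒜) (ComplexShape.up ℤ) j
  let φ := HomologicalComplex.singleMapHomologicalComplex (GMod.shift 𝒜 g) (ComplexShape.up ℤ) j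
  change (GMod.shift 𝒜 g).mapDerivedCategory.map (DerivedCategory.Q.map (S.map f)) ≫
      (GMod.shift 𝒜 g).mapDerivedCategoryFactors.hom.app (S.obj N) ≫
        DerivedCategory.Q.map (φ.hom.app N) =
    ((GMod.shift 𝒜 g).mapDerivedCategoryFactors.hom.app (S.obj M) ≫
        DerivedCategory.Q.map (φ.hom.app M)) ≫
      DerivedCategory.Q.map (S.map ((GMod.shift 𝒜 g).map f))
  have nat := φ.hom.naturality f
  simp only [Functor.comp_map] at nat
  rw [Functor.mapDerivedCategoryFactors_hom_naturality_assoc, Category.assoc]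
  erw [← Functor.map_comp, ← Functor.map_comp, nat]

instance (g : G) : (dShift 𝒜 g).Additive where
  map_add {_ _ f₁ f₂} := ObjectProperty.hom_ext _
    ((GMod.shift 𝒜 g).mapDerivedCategory.map_add (f := f₁.hom) (g := f₂.hom))

/-- The isomorphism `Π_s ≅ Π_g ∘ Π_h` on the bounded derived category when `g + h = s`. -/
def dShiftAdd' (𝒜 : G → Submodule k A) (g h s : G) (hs : g + h = s) :
    dShift 𝒜 s ≅ dShift 𝒜 h ⋙ dShift 𝒜 g :=
  eqToIso (by rw [hs]) ≪≫ dShiftAdd 𝒜 g h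

lemma dShiftAdd'_inv_app_hom (g h s : G) (hs : g + h = s) (X : Db 𝒜) :
    ((dShiftAdd' 𝒜 g h s hs).inv.app X).hom = (derShiftAdd' 𝒜 g h s hs).inv.app X.obj := by
  subst hs
  simp only [dShiftAdd', derShiftAdd', eqToIso_refl, Iso.refl_trans]
  rfl

/-- The functors `Π_g` and `Π_h` are inverse to each other when `g + h = 0`. -/
def dShiftInv (𝒜 : G → Submodule k A) (g h : G) (hs : g + h = 0) :
    dShift 𝒜 h ⋙ dShift 𝒜 g ≅ 𝟭 (Db 𝒜) :=
  (dShiftAdd' 𝒜 g h 0 hs).symm ≪≫ dShiftZero 𝒜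

instance (g : G) : (dShift 𝒜 g).IsEquivalence :=
  (CategoryTheory.Equivalence.mk (dShift 𝒜 g) (dShift 𝒜 (-g))
    (dShiftInv 𝒜 (-g) g (neg_add_cancel g)).symm
    (dShiftInv 𝒜 g (-g) (add_neg_cancel g))).isEquivalence_functor

variable [GradedAlgebra 𝒜]

/-- The action of a homogeneous element of the `G`-centre on the bounded derived category. -/
def dApp {g : G} (x : gCentreDeg 𝒜 g) (X : Db 𝒜) : X ⟶ (dShift 𝒜 g).obj X :=
  ObjectProperty.homMk (derApp x X.obj)

lemma dApp_naturality {g : G} (x : gCentreDeg 𝒜 g) {X Y : Db 𝒜} (f : X ⟶ Y) :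
    f ≫ dApp x Y = dApp x X ≫ (dShift 𝒜 g).map f :=
  ObjectProperty.hom_ext _ (derApp_naturality x f.hom)

lemma dApp_naturality_assoc {g : G} (x : gCentreDeg 𝒜 g) {X Y Z : Db 𝒜} (f : X ⟶ Y)
    (f' : (dShift 𝒜 g).obj Y ⟶ Z) :
    f ≫ dApp x Y ≫ f' = dApp x X ≫ (dShift 𝒜 g).map f ≫ f' := by
  rw [← Category.assoc, dApp_naturality, Category.assoc]

lemma dApp_add {g : G} (x y : gCentreDeg 𝒜 g) (X : Db 𝒜) :
    dApp (x + y) X = dApp x X + dApp y X :=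
  ObjectProperty.hom_ext _ (derApp_add x y X.obj)

lemma dApp_smul {g : G} (c : k) (x : gCentreDeg 𝒜 g) (X : Db 𝒜) :
    dApp (c • x) X = c • dApp x X :=
  ObjectProperty.hom_ext _ (derApp_smul c x X.obj)

lemma dApp_sub {g : G} (x y : gCentreDeg 𝒜 g) (X : Db 𝒜) :
    dApp (x - y) X = dApp x X - dApp y X := by
  have h : x - y + y = x := Subtype.ext (sub_add_cancel x.1 y.1)
  rw [eq_sub_iff_add_eq, ← dApp_add, h]

lemma dApp_zero {g : G} (X : Db 𝒜) : dApp (0 : gCentreDeg 𝒜 g) X = 0 := by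
  have := dApp_smul (0 : k) (0 : gCentreDeg 𝒜 g) X
  rwa [zero_smul, zero_smul] at this

lemma dApp_one (X : Db 𝒜) : dApp (oneDeg 𝒜) X ≫ (dShiftZero 𝒜).hom.app X = 𝟙 X :=
  ObjectProperty.hom_ext _ (derApp_one X.obj)

lemma dApp_mul {g h : G} (x : gCentreDeg 𝒜 g) (y : gCentreDeg 𝒜 h) (X : Db 𝒜) :
    dApp (mulDeg x y) X ≫ (dShiftAdd 𝒜 g h).hom.app X =
      dApp y X ≫ dApp x ((dShift 𝒜 h).obj X) :=
  ObjectProperty.hom_ext _ (derApp_mul x y X.obj)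

/-- Links the derived action to the module action; with full faithfulness of `singleF`, statements
about the `Π_h A` pass to any fixed cohomological degree. -/
lemma dApp_single {g : G} (x : gCentreDeg 𝒜 g) (j : ℤ) (M : GMod 𝒜) :
    dApp x ((singleF 𝒜 j).obj M) ≫ (dShiftSingle 𝒜 g j M).hom =
      (singleF 𝒜 j).map ((act x).app M) := by
  refine ObjectProperty.hom_ext _ ?_
  change derApp x (DerivedCategory.Q.obj
    ((HomologicalComplex.single (GMod 𝒜) (ComplexShape.up ℤ) j).obj M)) ≫
    (GMod.shift 𝒜 g).mapDerivedCategoryFactors.hom.app _ ≫ DerivedCategory.Q.map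
      ((HomologicalComplex.singleMapHomologicalComplex (GMod.shift 𝒜 g)
        (ComplexShape.up ℤ) j).hom.app M) = DerivedCategory.Q.map
      ((HomologicalComplex.single (GMod 𝒜) (ComplexShape.up ℤ) j).map ((act x).app M))
  rw [derApp_Q, Category.assoc, Iso.inv_hom_id_app_assoc, ← Functor.map_comp]
  congr 1
  apply HomologicalComplex.from_single_hom_ext
  rw [HomologicalComplex.comp_f, HomologicalComplex.singleMapHomologicalComplex_hom_app_self,
    HomologicalComplex.single_map_f_self]
  have nat := (act x).naturality
    (HomologicalComplex.singleObjXSelf (ComplexShape.up ℤ) j M).hom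
  rw [← Category.assoc]
  erw [← reassoc_of% nat]
  rfl

lemma dApp_translate {g : G} (l s : G) (hs : l + g = s) (hs' : g + l = s)
    (x : gCentreDeg 𝒜 g) (X : Db 𝒜) :
    (dShift 𝒜 l).map (dApp (translateDeg l x) X) ≫ (dShiftAdd' 𝒜 l g s hs).inv.app X =
      dApp x ((dShift 𝒜 l).obj X) ≫ (dShiftAdd' 𝒜 g l s hs').inv.app X := by
  refine ObjectProperty.hom_ext _ ?_
  refine (congrArg _ (dShiftAdd'_inv_app_hom l g s hs X)).trans
    ((derApp_translate l s hs hs' x X.obj).trans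
      (congrArg _ (dShiftAdd'_inv_app_hom g l s hs' X)).symm)

lemma derApp_eq_zero_of_iso {g : G} (x : gCentreDeg 𝒜 g) {X Y : DerivedCategory (GMod 𝒜)}
    (e : X ≅ Y) (h : derApp x X = 0) : derApp x Y = 0 := by
  rw [← cancel_epi e.hom, derApp_naturality, h, zero_comp, comp_zero]

lemma dApp_eq_zero_of_iso {g : G} (x : gCentreDeg 𝒜 g) {X Y : Db 𝒜}
    (e : X ≅ Y) (h : dApp x X = 0) : dApp x Y = 0 := by
  rw [← cancel_epi e.hom, dApp_naturality, h, zero_comp, comp_zero]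

/-- On complexes the action on `K⟦n⟧` is termwise the shift of the action on `K`, so vanishing
survives after `Q`. Vanishing, unlike `ActsAlike`, involves no `ξ`, and can therefore change
cohomological degree. -/
lemma derApp_shift_eq_zero {g : G} (x : gCentreDeg 𝒜 g) {X : DerivedCategory (GMod 𝒜)}
    (h : derApp x X = 0) (n : ℤ) : derApp x (X⟦n⟧) = 0 := by
  let K := DerivedCategory.Q.objPreimage X
  let e : DerivedCategory.Q.obj K ≅ X := DerivedCategory.Q.objObjPreimageIso X
  -- `X` is replaced by the image of a complex, where the action has an explicit formula.
  refine derApp_eq_zero_of_iso x ((DerivedCategory.Q.commShiftIso n).app K ≪≫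
    (shiftFunctor _ n).mapIso e) ?_
  have hK := derApp_eq_zero_of_iso x e.symm h
  rw [derApp_Q, Preadditive.IsIso.comp_right_eq_zero] at hK
  have hn : DerivedCategory.Q.map ((cApp x K)⟦n⟧') = 0 := by
    have nat := (DerivedCategory.Q.commShiftIso n).hom.naturality (cApp x K)
    simp only [Functor.comp_map, hK, Functor.map_zero, comp_zero] at nat
    rwa [Preadditive.IsIso.comp_right_eq_zero] at nat
  have hc : cApp x (K⟦n⟧) = (cApp x K)⟦n⟧' ≫
      (((GMod.shift 𝒜 g).mapHomologicalComplex (ComplexShape.up ℤ)).commShiftIso n).inv.app K := by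
    ext i
    exact (Category.comp_id _).symm
  change derApp x (DerivedCategory.Q.obj (K⟦n⟧)) = 0
  rw [derApp_Q, hc, Functor.map_comp, hn, zero_comp, zero_comp]

lemma dApp_shift_eq_zero {g : G} (x : gCentreDeg 𝒜 g) {X : Db 𝒜} (h : dApp x X = 0) (n : ℤ) :
    dApp x (X⟦n⟧) = 0 :=
  ObjectProperty.hom_ext _ (derApp_eq_zero_of_iso x
    (((DerivedCategory.Bounded.ι (C := GMod 𝒜)).commShiftIso n).app X).symm
    (derApp_shift_eq_zero x (congrArg (DerivedCategory.Bounded.ι (C := GMod 𝒜)).map h) n))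

end

/-! ### Detection on shifted regular modules in a fixed degree -/

section

open GMod

variable {𝒜 : G → Submodule k A} [GradedAlgebra 𝒜] [Module.Finite k A]

lemma exists_dApp_single {g : G} (j : ℤ)
    (η : ∀ h : G, (singleF 𝒜 j).obj (free 𝒜 h) ⟶ (dShift 𝒜 g).obj ((singleF 𝒜 j).obj (free 𝒜 h)))
    (hη : ∀ (h h' : G) (f : (singleF 𝒜 j).obj (free 𝒜 h) ⟶ (singleF 𝒜 j).obj (free 𝒜 h')),
      f ≫ η h' = η h ≫ (dShift 𝒜 g).map f) :
    ∃ x : gCentreDeg 𝒜 g, ∀ h, dApp x ((singleF 𝒜 j).obj (free 𝒜 h)) = η h := by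
  obtain ⟨x, hx⟩ := exists_act_free
    (fun h => (singleF 𝒜 j).preimage (η h ≫ (dShiftSingle 𝒜 g j _).hom)) (fun h h' f => by
      apply (singleF 𝒜 j).map_injective
      rw [Functor.map_comp, Functor.map_comp, Functor.map_preimage, Functor.map_preimage,
        Category.assoc, ← dShiftSingle_naturality, ← Category.assoc, ← Category.assoc, hη])
  refine ⟨x, fun h => ?_⟩
  rw [← cancel_mono (dShiftSingle 𝒜 g j _).hom, dApp_single, hx, Functor.map_preimage]

lemma eq_of_dApp_single {g : G} (j : ℤ) {x y : gCentreDeg 𝒜 g}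
    (h : ∀ h : G, dApp x ((singleF 𝒜 j).obj (free 𝒜 h)) =
      dApp y ((singleF 𝒜 j).obj (free 𝒜 h))) : x = y :=
  eq_of_act_free fun l => (singleF 𝒜 j).map_injective (by
    rw [← dApp_single, ← dApp_single, h])

/-- As `Π_g` preserves the cohomological degree, `ε` comes from a morphism of modules, which the
free modules detect. -/
lemma eq_zero_of_single_comp {g : G} {j : ℤ} {M : GMod 𝒜}
    (ε : (singleF 𝒜 j).obj M ⟶ (dShift 𝒜 g).obj ((singleF 𝒜 j).obj M))
    (h : ∀ (h : G) (f : (singleF 𝒜 j).obj (free 𝒜 h) ⟶ (singleF 𝒜 j).obj M), f ≫ ε = 0) :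
    ε = 0 := by
  have := eq_zero_of_free_comp
    ((singleF 𝒜 j).preimage (ε ≫ (dShiftSingle 𝒜 g j _).hom)) (fun l f => by
      apply (singleF 𝒜 j).map_injective
      rw [Functor.map_comp, Functor.map_preimage, ← Category.assoc, h, zero_comp,
        Functor.map_zero])
  rw [← cancel_mono (dShiftSingle 𝒜 g j _).hom, zero_comp,
    ← (singleF 𝒜 j).map_preimage (ε ≫ (dShiftSingle 𝒜 g j _).hom), this, Functor.map_zero]

end

/-! ### The structure maps of a graded functor are invertible -/

section

variable {𝒜 : G → Submodule k A} {ℬ : G → Submodule k B} {F : Db 𝒜 ⥤ Db ℬ}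

lemma natTrans_app_eq_of_iso {C D : Type*} [Category* C] [Category* D]
    {F F' : C ⥤ D} (τ : F ⟶ F') {X Y : C} (e : X ≅ Y) :
    τ.app Y = F.map e.inv ≫ τ.app X ≫ F'.map e.hom := by
  rw [← τ.naturality, ← Functor.map_comp_assoc, Iso.inv_hom_id, CategoryTheory.Functor.map_id,
    Category.id_comp]

namespace Intertwining

variable (I : Intertwining F)

lemma ξ_add' (g h s : G) (hs : g + h = s) (X : Db 𝒜) :
    F.map ((dShiftAdd' 𝒜 g h s hs).hom.app X) ≫ (I.ξ g).app ((dShift 𝒜 h).obj X) ≫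
        (dShift ℬ g).map ((I.ξ h).app X) =
      (I.ξ s).app X ≫ (dShiftAdd' ℬ g h s hs).hom.app (F.obj X) := by
  subst hs
  simp only [dShiftAdd', eqToIso_refl, Iso.refl_trans]
  exact I.ξ_add g h X

lemma isIso_zero (X : Db 𝒜) : IsIso ((I.ξ 0).app X) := by
  have : IsIso ((I.ξ 0).app X ≫ (dShiftZero ℬ).hom.app (F.obj X)) := by
    rw [I.ξ_zero]
    infer_instance
  exact IsIso.of_isIso_comp_right _ ((dShiftZero ℬ).hom.app (F.obj X))

/-- For `g + h = 0` the cocycle identity equates this composite, up to isomorphisms, with `ξ^0`,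
which the normalisation makes invertible. -/
lemma isIso_comp (g h : G) (hs : g + h = 0) (X : Db 𝒜) :
    IsIso ((I.ξ g).app ((dShift 𝒜 h).obj X) ≫ (dShift ℬ g).map ((I.ξ h).app X)) := by
  have := I.isIso_zero X
  have : IsIso (F.map ((dShiftAdd' 𝒜 g h 0 hs).hom.app X) ≫
      (I.ξ g).app ((dShift 𝒜 h).obj X) ≫ (dShift ℬ g).map ((I.ξ h).app X)) := by
    rw [I.ξ_add']
    infer_instance
  exact IsIso.of_isIso_comp_left (F.map ((dShiftAdd' 𝒜 g h 0 hs).hom.app X)) _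

/-- Every `X` is isomorphic to `Π_g (Π_{-g} X)` up to the order of the shifts, and there `ξ^g` is
the first factor of an isomorphism. -/
lemma mono_app (g : G) (X : Db 𝒜) : Mono ((I.ξ g).app X) := by
  let e : (dShift 𝒜 (-g)).obj ((dShift 𝒜 g).obj X) ≅ X :=
    (dShiftInv 𝒜 (-g) g (neg_add_cancel g)).app X
  have := I.isIso_comp g (-g) (add_neg_cancel g) ((dShift 𝒜 g).obj X)
  have := mono_of_mono ((I.ξ g).app ((dShift 𝒜 (-g)).obj ((dShift 𝒜 g).obj X)))
    ((dShift ℬ g).map ((I.ξ (-g)).app ((dShift 𝒜 g).obj X)))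
  rw [natTrans_app_eq_of_iso (I.ξ g) e]
  exact mono_comp' inferInstance (mono_comp' this inferInstance)

/-- In the invertible composite of `isIso_comp` the second factor is split epi, and it is mono
because `ξ^{-g}` is and `Π_g` is an equivalence. Hence it is invertible, and so is the first factor.
-/
instance isIso_app (g : G) (X : Db 𝒜) : IsIso ((I.ξ g).app X) := by
  let e : (dShift 𝒜 (-g)).obj ((dShift 𝒜 g).obj X) ≅ X :=
    (dShiftInv 𝒜 (-g) g (neg_add_cancel g)).app X
  let Y := (dShift 𝒜 g).obj X
  have hm : Mono ((dShift ℬ g).map ((I.ξ (-g)).app Y)) := by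
    have := I.mono_app (-g) Y
    infer_instance
  have hc := I.isIso_comp g (-g) (add_neg_cancel g) Y
  have : IsSplitEpi ((dShift ℬ g).map ((I.ξ (-g)).app Y)) :=
    ⟨⟨⟨inv ((I.ξ g).app ((dShift 𝒜 (-g)).obj Y) ≫ (dShift ℬ g).map ((I.ξ (-g)).app Y)) ≫
      (I.ξ g).app ((dShift 𝒜 (-g)).obj Y), by rw [Category.assoc, IsIso.inv_hom_id]⟩⟩⟩
  have := isIso_of_mono_of_isSplitEpi ((dShift ℬ g).map ((I.ξ (-g)).app Y))
  have : IsIso ((I.ξ g).app ((dShift 𝒜 (-g)).obj Y)) :=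
    IsIso.of_isIso_comp_right _ ((dShift ℬ g).map ((I.ξ (-g)).app Y))
  rw [natTrans_app_eq_of_iso (I.ξ g) e]
  exact IsIso.comp_isIso' inferInstance (IsIso.comp_isIso' this inferInstance)

/-- The isomorphism `F (Π_g X) ≅ Π_g (F X)`. -/
def iso (g : G) (X : Db 𝒜) : F.obj ((dShift 𝒜 g).obj X) ≅ (dShift ℬ g).obj (F.obj X) :=
  asIso ((I.ξ g).app X)

lemma iso_naturality (g : G) {X Y : Db 𝒜} (f : X ⟶ Y) :
    F.map ((dShift 𝒜 g).map f) ≫ (I.iso g Y).hom =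
      (I.iso g X).hom ≫ (dShift ℬ g).map (F.map f) :=
  (I.ξ g).naturality f

lemma iso_naturality_assoc (g : G) {X Y : Db 𝒜} {Z : Db ℬ} (f : X ⟶ Y)
    (f' : (dShift ℬ g).obj (F.obj Y) ⟶ Z) :
    F.map ((dShift 𝒜 g).map f) ≫ (I.iso g Y).hom ≫ f' =
      (I.iso g X).hom ≫ (dShift ℬ g).map (F.map f) ≫ f' := by
  rw [← Category.assoc, iso_naturality, Category.assoc]

lemma iso_inv_naturality (g : G) {X Y : Db 𝒜} (f : X ⟶ Y) :
    (I.iso g X).inv ≫ F.map ((dShift 𝒜 g).map f) =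
      (dShift ℬ g).map (F.map f) ≫ (I.iso g Y).inv := by
  rw [Iso.inv_comp_eq, ← iso_naturality_assoc, Iso.hom_inv_id, Category.comp_id]

lemma iso_zero (X : Db 𝒜) :
    (I.iso 0 X).hom ≫ (dShiftZero ℬ).hom.app (F.obj X) = F.map ((dShiftZero 𝒜).hom.app X) :=
  I.ξ_zero X

lemma iso_add (g h : G) (X : Db 𝒜) :
    (I.iso (g + h) X).hom ≫ (dShiftAdd ℬ g h).hom.app (F.obj X) =
      F.map ((dShiftAdd 𝒜 g h).hom.app X) ≫ (I.iso g ((dShift 𝒜 h).obj X)).hom ≫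
        (dShift ℬ g).map (I.iso h X).hom :=
  (I.ξ_add g h X).symm

lemma iso_add' (g h s : G) (hs : g + h = s) (X : Db 𝒜) :
    (I.iso g ((dShift 𝒜 h).obj X)).hom ≫ (dShift ℬ g).map (I.iso h X).hom ≫
      (dShiftAdd' ℬ g h s hs).inv.app (F.obj X) =
    F.map ((dShiftAdd' 𝒜 g h s hs).inv.app X) ≫ (I.iso s X).hom := by
  rw [← cancel_epi (F.map ((dShiftAdd' 𝒜 g h s hs).hom.app X)), ← Functor.map_comp_assoc,
    Iso.hom_inv_id_app, CategoryTheory.Functor.map_id, Category.id_comp]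
  have h₁ : F.map ((dShiftAdd' 𝒜 g h s hs).hom.app X) ≫ (I.iso g ((dShift 𝒜 h).obj X)).hom ≫
      (dShift ℬ g).map (I.iso h X).hom =
    (I.iso s X).hom ≫ (dShiftAdd' ℬ g h s hs).hom.app (F.obj X) := I.ξ_add' g h s hs X
  have h₂ := h₁ =≫ (dShiftAdd' ℬ g h s hs).inv.app (F.obj X)
  simp only [Category.assoc, Iso.hom_inv_id_app] at h₂
  rw [h₂]
  exact Category.comp_id _

end Intertwining

end

/-! ### Comparing the two `G`-centres along a graded functor -/

section

open GMod

variable {𝒜 : G → Submodule k A} {ℬ : G → Submodule k B} [GradedAlgebra 𝒜] [GradedAlgebra ℬ]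
  {F : Db 𝒜 ⥤ Db ℬ} (I : Intertwining F)

/-- Homogeneous elements of the two `G`-centres act on `X` and on `F X` in the same way. -/
def ActsAlike {g : G} (y : gCentreDeg 𝒜 g) (x : gCentreDeg ℬ g) (X : Db 𝒜) : Prop :=
  F.map (dApp y X) ≫ (I.iso g X).hom = dApp x (F.obj X)

variable {I}

lemma ActsAlike.of_iso {g : G} {y : gCentreDeg 𝒜 g} {x : gCentreDeg ℬ g} {X Y : Db 𝒜}
    (h : ActsAlike I y x X) (e : X ≅ Y) : ActsAlike I y x Y := by
  unfold ActsAlike at *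
  rw [← cancel_epi (F.map e.hom), ← Functor.map_comp_assoc, dApp_naturality,
    Functor.map_comp_assoc, I.iso_naturality, reassoc_of% h, dApp_naturality]

lemma ActsAlike.add [F.Additive] {g : G} {y y' : gCentreDeg 𝒜 g} {x x' : gCentreDeg ℬ g}
    {X : Db 𝒜} (h : ActsAlike I y x X) (h' : ActsAlike I y' x' X) :
    ActsAlike I (y + y') (x + x') X := by
  unfold ActsAlike at *
  rw [dApp_add, dApp_add, Functor.map_add, Preadditive.add_comp, h, h']

lemma ActsAlike.smul [F.Linear k] {g : G} (c : k) {y : gCentreDeg 𝒜 g} {x : gCentreDeg ℬ g}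
    {X : Db 𝒜} (h : ActsAlike I y x X) : ActsAlike I (c • y) (c • x) X := by
  unfold ActsAlike at *
  rw [dApp_smul, dApp_smul, Functor.map_smul, Linear.smul_comp, h]

lemma ActsAlike.one (X : Db 𝒜) : ActsAlike I (oneDeg 𝒜) (oneDeg ℬ) X := by
  unfold ActsAlike
  rw [← cancel_mono ((dShiftZero ℬ).hom.app (F.obj X)), Category.assoc, I.iso_zero,
    ← Functor.map_comp, dApp_one, dApp_one]
  exact CategoryTheory.Functor.map_id _ _

/-- The product acts by `y'` on `X` and then by `y` on `Π_h X`, which is why the first factor is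
compared at the shifted object. -/
lemma ActsAlike.mul {g h : G} {y : gCentreDeg 𝒜 g} {y' : gCentreDeg 𝒜 h}
    {x : gCentreDeg ℬ g} {x' : gCentreDeg ℬ h} {X : Db 𝒜}
    (hy : ActsAlike I y x ((dShift 𝒜 h).obj X)) (hy' : ActsAlike I y' x' X) :
    ActsAlike I (mulDeg y y') (mulDeg x x') X := by
  unfold ActsAlike at *
  rw [← cancel_mono ((dShiftAdd ℬ g h).hom.app (F.obj X)), dApp_mul, Category.assoc, I.iso_add,
    ← Functor.map_comp_assoc, dApp_mul, Functor.map_comp_assoc, reassoc_of% hy, ← hy',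
    Category.assoc, dApp_naturality]

/-- After applying the faithful functor `Π_l`, the translated action on `X` becomes the original
action on `Π_l X`. The cocycle identity is used for both orders `l + g` and `g + l`. -/
lemma ActsAlike.translate {g l : G} {y : gCentreDeg 𝒜 g} {x : gCentreDeg ℬ g} {X : Db 𝒜}
    (h : ActsAlike I y x ((dShift 𝒜 l).obj X)) :
    ActsAlike I (translateDeg l y) (translateDeg l x) X := by
  unfold ActsAlike at *
  apply (dShift ℬ l).map_injective
  rw [← cancel_epi (I.iso l X).hom,
    ← cancel_mono ((dShiftAdd' ℬ l g (l + g) rfl).inv.app (F.obj X)), Category.assoc,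
    Category.assoc, dApp_translate l (l + g) rfl (add_comm g l) x (F.obj X), Functor.map_comp,
    Category.assoc, ← I.iso_naturality_assoc, I.iso_add', ← Functor.map_comp_assoc,
    dApp_translate l (l + g) rfl (add_comm g l) y X, Functor.map_comp_assoc, ← I.iso_add',
    reassoc_of% h, dApp_naturality_assoc]

/-- Turns vanishing on `F X` into an instance of `ActsAlike`, so that it propagates from free
modules to all modules in one degree. -/
lemma actsAlike_zero_iff [F.Additive] {g : G} (x : gCentreDeg ℬ g) (X : Db 𝒜) :
    ActsAlike I 0 x X ↔ dApp x (F.obj X) = 0 := by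
  unfold ActsAlike
  rw [dApp_zero, Functor.map_zero, zero_comp, eq_comm]

section

variable [Module.Finite k A] [F.IsEquivalence]

variable (I) in
-- The action of `x`, corrected by the inverse of `ξ^g`, pulls back along the fully faithful `F` to
-- a natural family on the `Π_h A`, and such a family comes from the `G`-centre.
lemma exists_actsAlike_free {g : G} (x : gCentreDeg ℬ g) :
    ∃ y : gCentreDeg 𝒜 g, ∀ h, ActsAlike I y x ((singleF 𝒜 0).obj (free 𝒜 h)) := by
  obtain ⟨y, hy⟩ := exists_dApp_single (𝒜 := 𝒜) (g := g) 0
    (fun h => F.preimage (dApp x (F.obj _) ≫ (I.iso g _).inv))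
    (fun h h' f => by
      apply F.map_injective
      rw [Functor.map_comp, Functor.map_comp, Functor.map_preimage, Functor.map_preimage,
        dApp_naturality_assoc, Category.assoc, I.iso_inv_naturality])
  refine ⟨y, fun h => ?_⟩
  unfold ActsAlike
  rw [hy, Functor.map_preimage, Category.assoc, Iso.inv_hom_id, Category.comp_id]

/-- The defect `δ` of the relation is natural. By full faithfulness of `F` it comes from a map `M ⟶
Π_g M` in degree `j`, which is zero since it vanishes on all maps from free modules. -/
lemma ActsAlike.single [F.Additive] {g : G} {y : gCentreDeg 𝒜 g} {x : gCentreDeg ℬ g} {j : ℤ}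
    (h : ∀ h, ActsAlike I y x ((singleF 𝒜 j).obj (free 𝒜 h))) (M : GMod 𝒜) :
    ActsAlike I y x ((singleF 𝒜 j).obj M) := by
  let δ (X : Db 𝒜) : F.obj X ⟶ F.obj ((dShift 𝒜 g).obj X) :=
    F.map (dApp y X) - dApp x (F.obj X) ≫ (I.iso g X).inv
  have hδ : ∀ X, ActsAlike I y x X ↔ δ X = 0 := fun X => by
    rw [sub_eq_zero, Iso.eq_comp_inv]
    rfl
  have nat : ∀ {X Y : Db 𝒜} (f : X ⟶ Y), F.map f ≫ δ Y = δ X ≫ F.map ((dShift 𝒜 g).map f) := by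
    intro X Y f
    rw [Preadditive.comp_sub, Preadditive.sub_comp, ← Functor.map_comp, ← Functor.map_comp,
      dApp_naturality, dApp_naturality_assoc, Category.assoc, I.iso_inv_naturality]
  rw [hδ]
  have : F.preimage (δ ((singleF 𝒜 j).obj M)) = 0 := by
    refine eq_zero_of_single_comp _ fun l f => F.map_injective ?_
    rw [Functor.map_comp, Functor.map_preimage, nat, (hδ _).1 (h l), zero_comp, Functor.map_zero]
  rw [← F.map_preimage (δ _), this, Functor.map_zero]

lemma ActsAlike.dShift_single [F.Additive] {g : G} {y : gCentreDeg 𝒜 g} {x : gCentreDeg ℬ g}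
    {j : ℤ} (h : ∀ h, ActsAlike I y x ((singleF 𝒜 j).obj (free 𝒜 h))) (l : G) (M : GMod 𝒜) :
    ActsAlike I y x ((dShift 𝒜 l).obj ((singleF 𝒜 j).obj M)) :=
  (ActsAlike.single h _).of_iso (dShiftSingle 𝒜 l j M).symm

end

end

/-! ### The bijection between homogeneous components -/

section

open GMod

variable {𝒜 : G → Submodule k A} {ℬ : G → Submodule k B} [GradedAlgebra 𝒜] [GradedAlgebra ℬ]
  [Module.Finite k A]

lemma actsAlike_left_unique (e : Db 𝒜 ≌ Db ℬ) (I : Intertwining e.functor)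
    {g : G} {x : gCentreDeg ℬ g} {y y' : gCentreDeg 𝒜 g}
    (h : ∀ h, ActsAlike I y x ((singleF 𝒜 0).obj (free 𝒜 h)))
    (h' : ∀ h, ActsAlike I y' x ((singleF 𝒜 0).obj (free 𝒜 h))) : y = y' := by
  refine eq_of_dApp_single 0 fun l => e.functor.map_injective ?_
  have h₁ := h l
  have h₂ := h' l
  unfold ActsAlike at h₁ h₂
  rwa [← h₂, cancel_mono] at h₁

variable [Module.Finite k B]

/-- If the inverse of `F` sends the regular module to `N` in degree `n`, then `F` sends `Π_h N` in
degree `n` to `Π_h B`. -/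
def mapSingleIso (e : Db 𝒜 ≌ Db ℬ) (I : Intertwining e.functor) {n : ℤ} {N : GMod 𝒜}
    (i : e.inverse.obj (single ℬ 0 (regular ℬ)) ≅ single 𝒜 n N) (h : G) :
    e.functor.obj ((singleF 𝒜 n).obj ((GMod.shift 𝒜 h).obj N)) ≅
      (singleF ℬ 0).obj (free ℬ h) :=
  e.functor.mapIso (dShiftSingle 𝒜 h n N).symm ≪≫ I.iso h _ ≪≫
    (dShift ℬ h).mapIso (e.functor.mapIso i.symm ≪≫ e.counitIso.app _) ≪≫
      dShiftSingle ℬ h 0 (regular ℬ)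

/-- If the inverse of `F` sends the regular module to `N` in degree `n`, then `F` sends `Π_h N` in
degree `0` to `Π_h B` in degree `-n`. -/
def mapSingleZeroIso (e : Db 𝒜 ≌ Db ℬ) (I : Intertwining e.functor) [e.functor.CommShift ℤ]
    {n : ℤ} {N : GMod 𝒜}
    (i : e.inverse.obj (single ℬ 0 (regular ℬ)) ≅ single 𝒜 n N) (h : G) :
    e.functor.obj ((singleF 𝒜 0).obj ((GMod.shift 𝒜 h).obj N)) ≅
      (singleF ℬ (-n)).obj (free ℬ h) :=
  e.functor.mapIso (singleShift 𝒜 n 0 n (add_zero n) _).symm ≪≫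
    (e.functor.commShiftIso n).app _ ≪≫ (shiftFunctor (Db ℬ) n).mapIso (mapSingleIso e I i h) ≪≫
      singleShift ℬ n (-n) 0 (add_neg_cancel n) _

/-- Vanishing is shifted to degree `n`, spread there to every module, and evaluated at `Π_h N`,
whose image under `F` is `Π_h B`; there the action determines `x`. -/
lemma eq_zero_of_dApp_map_free (e : Db 𝒜 ≌ Db ℬ) (I : Intertwining e.functor)
    [e.functor.CommShift ℤ] [e.functor.Additive]
    (hB : IsInOneDegree 𝒜 (e.inverse.obj (single ℬ 0 (regular ℬ)))) {g : G} (x : gCentreDeg ℬ g)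
    (hx : ∀ h, dApp x (e.functor.obj ((singleF 𝒜 0).obj (free 𝒜 h))) = 0) : x = 0 := by
  obtain ⟨n, N, ⟨i⟩⟩ := hB
  have h₁ : ∀ h, ActsAlike I 0 x ((singleF 𝒜 n).obj (free 𝒜 h)) := fun h => by
    rw [actsAlike_zero_iff]
    exact dApp_eq_zero_of_iso x (((e.functor.commShiftIso (-n)).app _).symm ≪≫
      e.functor.mapIso (singleShift 𝒜 (-n) n 0 (neg_add_cancel n) _))
      (dApp_shift_eq_zero x (hx h) (-n))
  refine eq_of_dApp_single 0 fun h => ?_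
  rw [dApp_eq_zero_of_iso x (mapSingleIso e I i h)
    ((actsAlike_zero_iff x _).1 (ActsAlike.single h₁ _)), dApp_zero]

/-- The module `N` bridges the two sides: in degree `0` it lies within reach of `ActsAlike.single`,
while its image under `F` is a shifted regular module over `B`, so a natural family there defines an
element of the `G`-centre. -/
lemma exists_actsAlike_of_centre (e : Db 𝒜 ≌ Db ℬ) (I : Intertwining e.functor)
    (I' : Intertwining e.inverse) [e.functor.CommShift ℤ] [e.inverse.CommShift ℤ]
    [e.functor.Additive] [e.inverse.Additive]
    (hA : IsInOneDegree ℬ (e.functor.obj (single 𝒜 0 (regular 𝒜))))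
    (hB : IsInOneDegree 𝒜 (e.inverse.obj (single ℬ 0 (regular ℬ)))) {g : G}
    (y : gCentreDeg 𝒜 g) :
    ∃ x : gCentreDeg ℬ g, ∀ h, ActsAlike I y x ((singleF 𝒜 0).obj (free 𝒜 h)) := by
  obtain ⟨n, N, ⟨i⟩⟩ := hB
  let X (h : G) : Db 𝒜 := (singleF 𝒜 0).obj ((GMod.shift 𝒜 h).obj N)
  let c (h : G) := mapSingleZeroIso e I i h
  -- The family is the action of `y` on `Π_h N` carried through `F`, `ξ^g` and `c h`; degree `-n` is
  -- where `F` puts the image of `N` in degree `0`.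
  obtain ⟨x, hx⟩ := exists_dApp_single (𝒜 := ℬ) (g := g) (-n)
    (fun h => (c h).inv ≫ e.functor.map (dApp y (X h)) ≫ (I.iso g (X h)).hom ≫
      (dShift ℬ g).map (c h).hom)
    (fun h h' f => by
      obtain ⟨f', hf'⟩ := e.functor.map_surjective ((c h).hom ≫ f ≫ (c h').inv)
      have hf : f = (c h).inv ≫ e.functor.map f' ≫ (c h').hom := by
        rw [hf']
        simp
      have hc : (dShift ℬ g).map (c h).hom ≫ (dShift ℬ g).map (c h).inv = 𝟙 _ :=
        ((dShift ℬ g).mapIso (c h)).hom_inv_id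
      simp only [hf, Category.assoc, Iso.hom_inv_id_assoc, Functor.map_comp, reassoc_of% hc]
      rw [← e.functor.map_comp_assoc, dApp_naturality, Functor.map_comp_assoc,
        I.iso_naturality_assoc])
  have h₁ : ∀ h, ActsAlike I y x (X h) := fun h => by
    have := hx h
    rw [Iso.eq_inv_comp, dApp_naturality, ← Category.assoc (e.functor.map _), cancel_mono] at this
    exact this.symm
  -- So far `y` and `x` are compared only on the `Π_h N`. The partner `y'` of `x` is correct on free
  -- modules, hence on all modules in degree `0`, and it remains to see that `y' = y`.
  obtain ⟨y', hy'⟩ := exists_actsAlike_free I x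
  suffices y - y' = 0 by
    obtain rfl : y = y' := sub_eq_zero.1 this
    exact ⟨x, hy'⟩
  have hX : ∀ h, dApp (y - y') (X h) = 0 := fun h => by
    have h₂ : ActsAlike I y' x (X h) := ActsAlike.single hy' _
    have h₃ := h₁ h
    unfold ActsAlike at h₂ h₃
    rw [← h₂, cancel_mono] at h₃
    rw [dApp_sub, e.functor.map_injective h₃, sub_self]
  have : e.symm.functor.CommShift ℤ := inferInstanceAs (e.inverse.CommShift ℤ)
  have : e.symm.functor.Additive := inferInstanceAs e.inverse.Additive
  -- The vanishing criterion for the inverse equivalence asks that `y - y'` kill `F⁻¹ (Π_h B)`,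
  -- which is `X h` shifted by `-n`.
  refine eq_zero_of_dApp_map_free e.symm I' hA _ fun h => ?_
  exact dApp_eq_zero_of_iso _ (singleShift 𝒜 (-n) n 0 (neg_add_cancel n) _ ≪≫
    e.unitIso.app _ ≪≫ e.inverse.mapIso (mapSingleIso e I i h)) (dApp_shift_eq_zero _ (hX h) (-n))

/-- A strongly gradable derived equivalence induces isomorphisms of the homogeneous components of
the `G`-centres, compatible with products and with the action of `G`. -/
theorem exists_linearEquiv (e : Db 𝒜 ≌ Db ℬ) (I : Intertwining e.functor)
    (I' : Intertwining e.inverse) [e.functor.CommShift ℤ] [e.inverse.CommShift ℤ]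
    [e.functor.Additive] [e.inverse.Additive] [e.functor.Linear k]
    (hA : IsInOneDegree ℬ (e.functor.obj (single 𝒜 0 (regular 𝒜))))
    (hB : IsInOneDegree 𝒜 (e.inverse.obj (single ℬ 0 (regular ℬ)))) :
    ∃ φ : ∀ g : G, gCentreDeg 𝒜 g ≃ₗ[k] gCentreDeg ℬ g,
      φ 0 (oneDeg 𝒜) = oneDeg ℬ ∧
      (∀ (g h : G) (x : gCentreDeg 𝒜 g) (y : gCentreDeg 𝒜 h),
        φ (g + h) (mulDeg x y) = mulDeg (φ g x) (φ h y)) ∧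
      (∀ (g l : G) (x : gCentreDeg 𝒜 g), φ g (translateDeg l x) = translateDeg l (φ g x)) := by
  -- Uniqueness of `x` for given `y`; it also makes the chosen `φ` linear, multiplicative and
  -- equivariant, since both sides of each identity act like the same element.
  have hinj : ∀ {g : G} {y : gCentreDeg 𝒜 g} {x x' : gCentreDeg ℬ g},
      (∀ h, ActsAlike I y x ((singleF 𝒜 0).obj (free 𝒜 h))) →
      (∀ h, ActsAlike I y x' ((singleF 𝒜 0).obj (free 𝒜 h))) → x = x' := by
    intro g y x x' h h'
    refine sub_eq_zero.1 (eq_zero_of_dApp_map_free e I hB (x - x') fun l => ?_)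
    have h₁ := h l
    have h₂ := h' l
    unfold ActsAlike at h₁ h₂
    rw [dApp_sub, ← h₁, ← h₂, sub_self]
  choose φ hφ using fun (g : G) (y : gCentreDeg 𝒜 g) =>
    exists_actsAlike_of_centre e I I' hA hB y
  let φl (g : G) : gCentreDeg 𝒜 g →ₗ[k] gCentreDeg ℬ g :=
    { toFun := φ g
      map_add' := fun y y' => hinj (hφ g _) fun h => (hφ g y h).add (hφ g y' h)
      map_smul' := fun c y => hinj (hφ g _) fun h => (hφ g y h).smul c }
  have hb : ∀ g, Function.Bijective (φl g) := fun g => by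
    refine ⟨fun y y' h => ?_, fun x => ?_⟩
    · have h : φ g y = φ g y' := h
      exact actsAlike_left_unique e I (hφ g y) (h ▸ hφ g y')
    · obtain ⟨y, hy⟩ := exists_actsAlike_free I x
      exact ⟨y, hinj (hφ g y) hy⟩
  refine ⟨fun g => LinearEquiv.ofBijective (φl g) (hb g), ?_, ?_, ?_⟩
  · exact hinj (hφ 0 _) fun h => ActsAlike.one _
  · intro g h x y
    -- The left factor has to be compared on `Π_h` of a free module, which is again a module in
    -- degree `0`.
    exact hinj (hφ _ _) fun l =>
      (ActsAlike.dShift_single (hφ g x) h _).mul (hφ h y l)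
  · intro g l x
    exact hinj (hφ _ _) fun h => (ActsAlike.dShift_single (hφ g x) l _).translate

end

/-! ### The grading of the `G`-centre -/

section

open GMod

variable (𝒜 : G → Submodule k A) [GradedAlgebra 𝒜]

instance : SetLike.GradedMonoid (gCentreDeg 𝒜) where
  one_mem := (oneDeg 𝒜).2
  mul_mem _ _ x y hx hy := (mulDeg ⟨x, hx⟩ ⟨y, hy⟩).2

/-- The homogeneous component of degree `g` of an element of the `G`-centre. -/
def gCentreComponent (g : G) : gCentre 𝒜 →ₗ[k] gCentreDeg 𝒜 g where
  toFun x := ⟨⟨fun l => DirectSum.decompose 𝒜 (x.1 l) g, fun l h y hy => by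
    -- For `y` of degree `h`, the component of degree `g + h` of the centre relation is the centre
    -- relation for the components of degree `g`.
    rw [← DirectSum.coe_decompose_mul_add_of_right_mem 𝒜 hy, x.2 l h y hy, add_comm g h,
      DirectSum.coe_decompose_mul_add_of_left_mem 𝒜 hy]⟩, fun l => SetLike.coe_mem _⟩
  map_add' x y := Subtype.ext (Subtype.ext (funext fun l => by simp))
  map_smul' c x := Subtype.ext (Subtype.ext (funext fun l => by
    simp only [SetLike.val_smul, Pi.smul_apply, DirectSum.decompose_smul]
    rfl))

lemma gCentreComponent_apply (g : G) (x : gCentre 𝒜) (l : G) :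
    (gCentreComponent 𝒜 g x).1.1 l = DirectSum.decompose 𝒜 (x.1 l) g := rfl

lemma gCentreComponent_self {g : G} (z : gCentreDeg 𝒜 g) : gCentreComponent 𝒜 g z = z :=
  Subtype.ext (Subtype.ext (funext fun l => DirectSum.decompose_of_mem_same 𝒜 (z.2 l)))

lemma gCentreComponent_of_ne {g h : G} (hgh : h ≠ g) (z : gCentreDeg 𝒜 h) :
    gCentreComponent 𝒜 g z = 0 :=
  Subtype.ext (Subtype.ext (funext fun l => DirectSum.decompose_of_mem_ne 𝒜 (z.2 l) hgh))

variable [Module.Finite k A]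

/-- Finite dimensionality bounds the degrees that occur uniformly over all values of a function `G →
A`, so the homogeneous decomposition is a finite sum even when `G` is infinite. -/
lemma finite_support : {g | 𝒜 g ≠ ⊥}.Finite :=
  WellFoundedGT.finite_ne_bot_of_iSupIndep
    (DirectSum.Decomposition.isInternal 𝒜).submodule_iSupIndep

/-- The `G`-centre is the direct sum of its homogeneous components. -/
instance : DirectSum.Decomposition (gCentreDeg 𝒜) where
  decompose' x := ∑ g ∈ (finite_support 𝒜).toFinset,
    DirectSum.of (fun g => gCentreDeg 𝒜 g) g (gCentreComponent 𝒜 g x)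
  left_inv x := by
    rw [map_sum]
    refine Subtype.ext (funext fun l => ?_)
    simp only [DirectSum.coeAddMonoidHom_of]
    rw [AddSubmonoidClass.coe_finsetSum, Finset.sum_apply]
    simp only [gCentreComponent_apply]
    classical
    conv_rhs => rw [← DirectSum.sum_support_decompose 𝒜 (x.1 l)]
    refine (Finset.sum_subset (fun g hg => ?_) fun g _ hg => ?_).symm
    · rw [Set.Finite.mem_toFinset, Set.mem_ofPred_eq]
      intro h
      refine DFinsupp.mem_support_iff.1 hg (Subtype.ext ?_)
      exact (Submodule.mem_bot k).1 (h.le (DirectSum.decompose 𝒜 (x.1 l) g).2)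
    · rw [DFinsupp.notMem_support_iff.1 hg]
      rfl
  right_inv z := by
    induction z using DirectSum.induction_on with
    | zero => simp
    | add z z' hz hz' =>
      conv_rhs => rw [← hz, ← hz']
      simp [Finset.sum_add_distrib]
    | of h z =>
      rw [DirectSum.coeAddMonoidHom_of]
      refine (Finset.sum_eq_single h ?_ ?_).trans ?_
      · intro g _ hg
        rw [gCentreComponent_of_ne 𝒜 hg.symm, map_zero]
      · intro hh
        rw [Set.Finite.mem_toFinset, Set.mem_ofPred_eq, not_not] at hh
        have : z = 0 := Subtype.ext (Subtype.ext (funext fun l => by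
          exact (Submodule.mem_bot k).1 (hh.le (z.2 l))))
        rw [gCentreComponent_self, this, map_zero]
      · rw [gCentreComponent_self]

instance : GradedAlgebra (gCentreDeg 𝒜) where

end

/-- By multiplicativity of `χ`, the condition at `0` says that `x` is an eigenvector for the action
of `G`, so any linear equivariant bijection preserves it. -/
lemma mem_gCentreChar_iff {H : Type*} [AddCommGroup H] (𝒜 : H → Submodule k A)
    (χ : AddChar H kˣ) (x : gCentre 𝒜) :
    x ∈ gCentreChar 𝒜 χ ↔ ∀ l, gCentreAct 𝒜 l x = (χ l : k) • x := by
  constructor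
  · intro h l
    refine Subtype.ext (funext fun g => ?_)
    change x.1 (l + g) = (χ l : k) • x.1 g
    rw [h (l + g), h g, smul_smul, AddChar.map_add_eq_mul, Units.val_mul]
  · intro h l
    have := congrFun (congrArg Subtype.val (h l)) 0
    change x.1 (l + 0) = (χ l : k) • x.1 0 at this
    rwa [add_zero] at this

/-! ### Algebra isomorphisms assembled from homogeneous components -/

section

variable {Z W : Type*} [Ring Z] [Algebra k Z] [Ring W] [Algebra k W]
  (𝒵 : G → Submodule k Z) [GradedAlgebra 𝒵] (𝒲 : G → Submodule k W)

/-- The algebra homomorphism given by compatible maps of homogeneous components. -/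
def gradedAlgHom (φ : ∀ g, 𝒵 g →ₗ[k] 𝒲 g)
    (h₁ : (φ 0 ⟨1, SetLike.one_mem_graded 𝒵⟩ : W) = 1)
    (h₂ : ∀ (g h : G) (x : 𝒵 g) (y : 𝒵 h),
      (φ (g + h) ⟨x.1 * y.1, SetLike.mul_mem_graded x.2 y.2⟩ : W) = (φ g x : W) * (φ h y : W)) :
    Z →ₐ[k] W :=
  (DirectSum.toAlgebra k (fun g => 𝒵 g) (fun g => (𝒲 g).subtype ∘ₗ φ g) h₁
    (fun x y => h₂ _ _ x y)).comp (DirectSum.decomposeAlgEquiv 𝒵).toAlgHom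

lemma gradedAlgHom_coe (φ : ∀ g, 𝒵 g →ₗ[k] 𝒲 g)
    (h₁ : (φ 0 ⟨1, SetLike.one_mem_graded 𝒵⟩ : W) = 1)
    (h₂ : ∀ (g h : G) (x : 𝒵 g) (y : 𝒵 h),
      (φ (g + h) ⟨x.1 * y.1, SetLike.mul_mem_graded x.2 y.2⟩ : W) = (φ g x : W) * (φ h y : W))
    {g : G} (x : 𝒵 g) : gradedAlgHom 𝒵 𝒲 φ h₁ h₂ x = φ g x := by
  have : DirectSum.decomposeAlgEquiv 𝒵 (x : Z) = DirectSum.of (fun g => 𝒵 g) g x :=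
    DirectSum.decompose_coe 𝒵 x
  rw [gradedAlgHom, AlgHom.comp_apply]
  erw [this]
  exact DirectSum.toAddMonoid_of (fun g => ((𝒲 g).subtype ∘ₗ φ g).toAddMonoidHom) g x

/-- The inverses of the component maps are again unital and multiplicative, so both directions
extend to algebra maps, and they are mutually inverse on homogeneous elements. -/
lemma exists_algEquiv_of_graded [GradedAlgebra 𝒲] (φ : ∀ g, 𝒵 g ≃ₗ[k] 𝒲 g)
    (h₁ : (φ 0 ⟨1, SetLike.one_mem_graded 𝒵⟩ : W) = 1)
    (h₂ : ∀ (g h : G) (x : 𝒵 g) (y : 𝒵 h),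
      (φ (g + h) ⟨x.1 * y.1, SetLike.mul_mem_graded x.2 y.2⟩ : W) = (φ g x : W) * (φ h y : W)) :
    ∃ Φ : Z ≃ₐ[k] W, ∀ (g : G) (x : 𝒵 g), Φ x = φ g x := by
  let f := gradedAlgHom 𝒵 𝒲 (fun g => (φ g).toLinearMap) h₁ h₂
  let f' := gradedAlgHom 𝒲 𝒵 (fun g => (φ g).symm.toLinearMap)
    (by
      have : (⟨1, SetLike.one_mem_graded 𝒲⟩ : 𝒲 0) = φ 0 ⟨1, SetLike.one_mem_graded 𝒵⟩ :=
        Subtype.ext h₁.symm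
      rw [this]
      simp)
    (fun g h x y => by
      obtain ⟨x, rfl⟩ := (φ g).surjective x
      obtain ⟨y, rfl⟩ := (φ h).surjective y
      have : (⟨(φ g x : W) * (φ h y : W), SetLike.mul_mem_graded (φ g x).2 (φ h y).2⟩ :
          𝒲 (g + h)) = φ (g + h) ⟨x.1 * y.1, SetLike.mul_mem_graded x.2 y.2⟩ :=
        Subtype.ext (h₂ g h x y).symm
      rw [this]
      simp)
  have hf : ∀ (g : G) (x : 𝒵 g), f x = φ g x := fun g x => gradedAlgHom_coe 𝒵 𝒲 _ _ _ x
  have hf' : ∀ (g : G) (x : 𝒲 g), f' x = (φ g).symm x := fun g x =>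
    gradedAlgHom_coe 𝒲 𝒵 _ _ _ x
  refine ⟨AlgEquiv.ofAlgHom f f' ?_ ?_, hf⟩
  · refine AlgHom.ext fun x => ?_
    induction x using DirectSum.Decomposition.inductionOn 𝒲 with
    | zero => simp
    | add x y hx hy => rw [map_add, hx, hy, map_add]
    | homogeneous x => simp [hf, hf']
  · refine AlgHom.ext fun x => ?_
    induction x using DirectSum.Decomposition.inductionOn 𝒵 with
    | zero => simp
    | add x y hx hy => rw [map_add, hx, hy, map_add]
    | homogeneous x => simp [hf, hf']

end

end GCentre

end

/-! ### Conclusion -/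

theorem mainTheorem1 {k : Type*} [Field k] [IsAlgClosed k]
    {G : Type*} [AddCommGroup G] [DecidableEq G]
    {A : Type*} [Ring A] [Algebra k A] [Module.Finite k A]
    {B : Type*} [Ring B] [Algebra k B] [Module.Finite k B]
    (𝒜 : G → Submodule k A) [GradedAlgebra 𝒜]
    (ℬ : G → Submodule k B) [GradedAlgebra ℬ]
    (hAB : GCentre.StronglyGradableDerivedEquivalent 𝒜 ℬ) :
    ∃ φ : GCentre.gCentre 𝒜 ≃ₐ[k] GCentre.gCentre ℬ,
      (∀ g : G, (GCentre.gCentreDeg 𝒜 g).map φ.toLinearMap = GCentre.gCentreDeg ℬ g) ∧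
      (∀ (g : G) (χ : AddChar G kˣ),
        (GCentre.gCentreBideg 𝒜 g χ).map φ.toLinearMap = GCentre.gCentreBideg ℬ g χ) ∧
      (∀ (l : G) (x : GCentre.gCentre 𝒜),
        φ (GCentre.gCentreAct 𝒜 l x) = GCentre.gCentreAct ℬ l (φ x)) := by
  obtain ⟨e, ⟨_, ⟨_, _⟩, ⟨I⟩⟩, ⟨_, ⟨_, _⟩, ⟨I'⟩⟩, hA, hB⟩ := hAB
  -- Additivity follows from preservation of binary products.
  have := CategoryTheory.Functor.additive_of_preserves_binary_products e.functor
  have := CategoryTheory.Functor.additive_of_preserves_binary_products e.inverse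
  obtain ⟨φ, hφ₁, hφm, hφt⟩ := GCentre.exists_linearEquiv e I I' hA hB
  obtain ⟨Φ, hΦ⟩ := GCentre.exists_algEquiv_of_graded (GCentre.gCentreDeg 𝒜)
    (GCentre.gCentreDeg ℬ) φ (congrArg Subtype.val hφ₁) (fun g h x y => congrArg Subtype.val (hφm g h x y))
  have hact : ∀ (l : G) (x : GCentre.gCentre 𝒜),
      Φ (GCentre.gCentreAct 𝒜 l x) = GCentre.gCentreAct ℬ l (Φ x) := by
    intro l x
    induction x using DirectSum.Decomposition.inductionOn (GCentre.gCentreDeg 𝒜) with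
    | zero => exact (map_zero Φ).trans (congrArg (GCentre.gCentreAct ℬ l) (map_zero Φ)).symm
    | add x y hx hy =>
      rw [map_add]
      refine (map_add Φ (GCentre.gCentreAct 𝒜 l x) (GCentre.gCentreAct 𝒜 l y)).trans ?_
      rw [hx, hy]
      rfl
    | @homogeneous g x =>
      rw [hΦ]
      exact (hΦ g (GCentre.GMod.translateDeg l x)).trans (congrArg Subtype.val (hφt g l x))
  have hdeg : ∀ (g : G) (x : GCentre.gCentre 𝒜),
      Φ x ∈ GCentre.gCentreDeg ℬ g ↔ x ∈ GCentre.gCentreDeg 𝒜 g := by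
    intro g x
    constructor
    · intro hx
      obtain ⟨y, hy⟩ := (φ g).surjective ⟨Φ x, hx⟩
      have : Φ y = Φ x := by rw [hΦ, hy]
      rw [← Φ.injective this]
      exact y.2
    · intro hx
      rw [hΦ g ⟨x, hx⟩]
      exact (φ g _).2
  have hchar : ∀ (χ : AddChar G kˣ) (x : GCentre.gCentre 𝒜),
      Φ x ∈ GCentre.gCentreChar ℬ χ ↔ x ∈ GCentre.gCentreChar 𝒜 χ := by
    intro χ x
    -- The eigenvector form of the condition passes through `Φ` by equivariance and linearity.
    rw [GCentre.mem_gCentreChar_iff, GCentre.mem_gCentreChar_iff]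
    refine forall_congr' fun l => ?_
    rw [← hact, ← map_smul, Φ.injective.eq_iff]
  have hmap : ∀ (S : Submodule k (GCentre.gCentre 𝒜)) (T : Submodule k (GCentre.gCentre ℬ)),
      (∀ x, Φ x ∈ T ↔ x ∈ S) → S.map Φ.toLinearMap = T := by
    intro S T h
    ext z
    obtain ⟨x, rfl⟩ := Φ.surjective z
    rw [h]
    exact ⟨fun ⟨y, hy, hyx⟩ => Φ.injective hyx ▸ hy, fun hx => ⟨x, hx, rfl⟩⟩
  exact ⟨Φ, fun g => hmap _ _ (hdeg g),
    fun g χ => hmap _ _ fun x => and_congr (hdeg g x) (hchar χ x), hact⟩
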